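/- **Setting.** Let $Q$ be a full conjunctive query over attributes $a_1,\dots,a_m$ ($m\ge 1$, in a fixed order) and relations $R_1,\dots,R_n$, each a nonempty finite set of tuples over its own set of attributes, every attribute occurring in some relation. Let $\mathrm{IN}=\sum_i|R_i|$ and let $MaxOut_Q=\inf_x\prod_i|R_i|^{x_i}$ be the AGM bound ($x$ ranging over the fractional edge covers of $Q$). For a prefix $p=(a_1,\dots,a_j)$ let $Ext^i_j(p)$ be the set of values of $a_{j+1}$ in the tuples of $R_i$ that match $p$. There are $w\ge 1$ workers. Three indices are stored, each entry at the worker given by a hash of its key: the sizes $|Ext^i_j(p)|$, with key the projection of $p$ to $R_i$; the $k$-th elements of $Ext^i_j(p)$, with key this projection and $k$; and the projections of $(p\bullet e)$ to $R_i$, used to test $e\in Ext^i_j(p)$. The hash function is ideal: distinct keys go to independent uniform workers. **BiGJoin-S** with batch parameter $B'$ starts from the empty prefix. Level $j$ consists of tuples $(p,i,\mathrm{start},\mathrm{end})$, stored at the workers: these extensions of the prefix $p$ in $R_i$ still have to be proposed, each being one unit of work. A batch of level $j$ has the following synchronous steps. *Extension-Resolve*: each worker takes up to $B'$ units $(p,k)$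 of its work and looks up the corresponding candidates $p\bullet e$. *Intersect*: for each $R_i$ containing $a_{j+1}$ in turn, each worker looks up which of its candidates are in $Ext^i_j$ and discards the others. The survivors are prefixes $p'$ of length $j+1$; if $j+1=m$ they are written out as results. Otherwise *Count*: by one look-up for each $R_i$ containing $a_{j+2}$, the relation with the fewest extensions of $p'$ is found, and *Balance*: each worker distributes its new work over the $w$ workers by sending them level-$(j+1)$ tuples. (At the start, Count and Balance are applied to the empty prefix.) A look-up takes two rounds (request and answer), and each worker first aggregates its requests with equal keys into one. In Balance each target gets a $1/w$ share of the work of each sender up to one unit, both now and cumulatively over all batches of the level; for this, the sender first deals out uncut the same number of tuples of at most average work to every target (as many as possible), and then lays the remaining tuples in a row and cuts it greedily into the missing shares. The next batch is taken at the largest level at which all workers have at least $B'$ units of work; if there is none, at the smallest level with work left; if there is no work left, the algorithm ends. Costs are counted in tuples: each tuple sent is a unit of communication, each tuple handled and each look-up served a unit of computation. They are counted from the moment the indices are in place; the index entries count for memory and load. The cumulative memory is the maximum over the rounds of the total number of tuples stored (index entries included, written results excluded). The load is the maximum number of tuples received by a worker in a round, the initial share $\lceil \mathrm{IN}/w\rceil$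 of the input and the index entries of a worker counting as received in preliminary rounds. **Theorem.** Assume $B'/w\ge\max\{w,\log(\mathrm{IN}\cdot MaxOut_Q)\}$ and set $B=wB'$. All $O$-constants below are absolute. BiGJoin-S terminates with exactly the results of $Q$ as output and, for every outcome of the hash function, - its cumulative computation and its cumulative communication are $O(mn\,MaxOut_Q)$, and its cumulative memory is $O(mn\,\mathrm{IN}+mB)$; - it runs in $O(mn\lceil MaxOut_Q/B\rceil)$ rounds, hence in $O(mn\,MaxOut_Q/B)$ rounds if $B\le MaxOut_Q$. Moreover, with probability at least $1-O\big(\tfrac1{\mathrm{IN}}\max\{1,\tfrac m{\mathrm{IN}}\}\big)$ (that is, $1-O(1/\mathrm{IN})$ if $m\le\mathrm{IN}$, and also if $m$ is fixed) the following hold together: - every worker does $O(B')$ communication and computation in each round; - the load is $O(mn\,\mathrm{IN}/w+mB')$; - if $B'<\mathrm{IN}/w$, the load is optimal up to a factor $O(mn)$: for every placement of the input tuples on $w$ workers, it is at most $O(mn)$ times the largest number of input tuples on one worker, a lower bound for the load of any algorithm starting from that placement. -/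

import Mathlib

open MeasureTheory ProbabilityTheory

noncomputable section

namespace BiGJoinS

open scoped Classical

/-! ## Queries, input sizes and the AGM bound -/

/-- A full conjunctive query over the attributes `0, …, m - 1` (in the global order) and `n`
relations, together with the input: the `i`-th relation is a finite set of tuples over its own
set `attrs i` of attributes. -/
structure Instance (m n : ℕ) (V : Type*) where
  attrs : Fin n → Finset (Fin m)
  rel : (i : Fin n) → Finset ({a // a ∈ attrs i} → V)

namespace Instance

variable {m n : ℕ} {V : Type*} (D : Instance m n V)

/-- The input size `IN = ∑ i, |R_i|`. -/
def inputSize : ℕ := ∑ i, (D.rel i).card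

/-- Every attribute of the query occurs in some relation. -/
def Covered : Prop := ∀ a : Fin m, ∃ i, a ∈ D.attrs i

/-- A fractional edge cover of the query hypergraph. -/
def IsFractionalEdgeCover (x : Fin n → ℝ) : Prop :=
  (∀ i, 0 ≤ x i) ∧ ∀ a : Fin m, 1 ≤ ∑ i, if a ∈ D.attrs i then x i else 0

/-- `MaxOut_Q`, the AGM bound of the query for the given relation sizes: the minimum of
`∏ i, |R_i| ^ x_i` over the fractional edge covers `x`. -/
def maxOut : ℝ :=
  ⨅ x : {x : Fin n → ℝ // D.IsFractionalEdgeCover x}, ∏ i, ((D.rel i).card : ℝ) ^ (x.1 i)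

/-- `x` is a result of the query: its restriction to the attributes of each relation is a tuple of
that relation. -/
def IsResult (x : Fin m → V) : Prop := ∀ i, (fun a : {a // a ∈ D.attrs i} => x a.1) ∈ D.rel i

/-! ## Extension indices

A prefix `j`-tuple is a list of `j` values, for the attributes `0, …, j - 1`; the candidate
extension `p • e` is `p ++ [e]`. A projection of a prefix or of a tuple is a partial assignment
`ℕ → Option V` of values to attributes. -/

/-- The relation `R_i` contains the attribute number `a`. -/
def Binds (i : Fin n) (a : ℕ) : Prop := ∃ h : a < m, (⟨a, h⟩ : Fin m) ∈ D.attrs i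

/-- The values of the prefix `p` at the attributes bound by `R_i`. -/
def proj (i : Fin n) (p : List V) : ℕ → Option V := fun a => if D.Binds i a then p[a]? else none

/-- The value of a tuple of `R_i` at attribute number `a`, if `R_i` contains that attribute. -/
def value (i : Fin n) (t : {a // a ∈ D.attrs i} → V) (a : ℕ) : Option V :=
  if h : D.Binds i a then some (t ⟨⟨a, h.1⟩, h.2⟩) else none

/-- The projection of a tuple of `R_i` on those of its attributes that are among the first `j`. -/
def restrict (i : Fin n) (j : ℕ) (t : {a // a ∈ D.attrs i} → V) : ℕ → Option V :=
  fun a => if a < j then D.value i t a else none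

/-- The projection of `R_i` on those of its attributes that are among the first `j`. -/
def prefixes (i : Fin n) (j : ℕ) : Finset (ℕ → Option V) := (D.rel i).image (D.restrict i j)

/-- The values of attribute number `j` in the tuples of `R_i` that match `q` on the first `j`
attributes. -/
def extOf (i : Fin n) (j : ℕ) (q : ℕ → Option V) : Finset V :=
  ((D.rel i).filter (fun t => D.restrict i j t = q)).biUnion (fun t => (D.value i t j).toFinset)

/-- The extension set of the prefix `p` in `R_i`. -/
def ext (i : Fin n) (p : List V) : Finset V := D.extOf i p.length (D.proj i p)

/-- Membership test for a candidate extension `c = p • e`: `e` is in the extension set of `p`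
in `R_i`. -/
def InExt (i : Fin n) (c : List V) : Prop := D.proj i c ∈ D.prefixes i c.length

/-- The relations containing the attribute number `j`, in order. -/
def relsAt (j : ℕ) : List (Fin n) := (List.finRange n).filter (fun i => D.Binds i j)

end Instance

/-- Keys of the three skew-resilient indices of each relation `i` and each level `j`.
`count i j q` : the number of extensions of `q`; `res i j q k` : the extension number `k` of `q`
(numbered from `0`); `mem i j q` : existence of the projected candidate extension `q`. -/
inductive Key (n : ℕ) (V : Type*)
  | count (i : Fin n) (j : ℕ) (q : ℕ → Option V)
  | res (i : Fin n) (j : ℕ) (q : ℕ → Option V) (k : ℕ)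
  | mem (i : Fin n) (j : ℕ) (q : ℕ → Option V)

/-- All index entries; an entry is stored at the worker to which its key is hashed. -/
def Instance.indexKeys {m n : ℕ} {V : Type*} (D : Instance m n V) : Finset (Key n V) :=
  Finset.univ.biUnion fun i => ((Finset.range m).filter (fun j => D.Binds i j)).biUnion fun j =>
    (D.prefixes i j).image (Key.count i j) ∪
    ((D.prefixes i j).biUnion fun q =>
      (Finset.range (D.extOf i j q).card).image (Key.res i j q)) ∪
    (D.prefixes i (j + 1)).image (Key.mem i j)

/-- The number of index entries stored at worker `k` when the keys are distributed by `h`. -/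
def indexSize {m n : ℕ} {V : Type*} (D : Instance m n V) {w : ℕ} (h : Key n V → Fin w)
    (k : Fin w) : ℕ := (D.indexKeys.filter (fun κ => h κ = k)).card

/-- An idealized random hash function: the keys are sent to independent uniform workers. -/
structure IsRandomHash {K Ω : Type*} [MeasurableSpace Ω] {w : ℕ} (μ : Measure Ω)
    (H : K → Ω → Fin w) : Prop where
  measurable : ∀ κ, Measurable (H κ)
  indep : iIndepFun H μ
  uniform : ∀ κ k, μ.real {ω | H κ ω = k} = 1 / (w : ℝ)

/-! ## Rounds and their costs -/

/-- One synchronous round on `w` workers. -/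
structure Round (w : ℕ) where
  /-- the messages of the round as (sender, receiver) pairs, one for each tuple that is sent -/
  msgs : List (Fin w × Fin w)
  /-- the units of local computation: one for each tuple handled and each index look-up served -/
  comp : Fin w → ℕ
  /-- the tuples that a worker stores, besides index entries and the messages it receives -/
  held : Fin w → ℕ

namespace Round

variable {w : ℕ} (r : Round w)

def sent (k : Fin w) : ℕ := r.msgs.countP (fun e => e.1 = k)

def received (k : Fin w) : ℕ := r.msgs.countP (fun e => e.2 = k)

end Round

/-! ## Prefix tuples carrying ranges of extensions -/

/-- The tuple `(p, min-i, start, end)`: the extensions number `lo, …, hi - 1` of `pre` in the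
relation `rel` still have to be proposed. -/
structure Piece (n : ℕ) (V : Type*) where
  pre : List V
  rel : Fin n
  lo : ℕ
  hi : ℕ

namespace Piece

variable {n : ℕ} {V : Type*}

/-- The number of candidate extensions that a piece stands for. -/
def work (t : Piece n V) : ℕ := t.hi - t.lo

/-- The `(p, k)` tuples (with `min-i`) that a piece stands for. -/
def units (t : Piece n V) : List (List V × Fin n × ℕ) :=
  (List.range' t.lo t.work).map fun k => (t.pre, t.rel, k)

/-- The total number of candidate extensions of a list of pieces. -/
def total (L : List (Piece n V)) : ℕ := (L.map work).sum

/-- The pieces for the first `b` units of work of a list of pieces; at most one piece is cut. -/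
def takeWork : ℕ → List (Piece n V) → List (Piece n V)
  | _, [] => []
  | b, t :: ts =>
    if b = 0 then []
    else if t.work ≤ b then t :: takeWork (b - t.work) ts
    else [{ t with hi := t.lo + b }]

/-- What remains of a list of pieces after its first `b` units of work. -/
def dropWork : ℕ → List (Piece n V) → List (Piece n V)
  | _, [] => []
  | b, t :: ts =>
    if t.work ≤ b then dropWork (b - t.work) ts else { t with lo := t.lo + b } :: ts

end Piece

/-! ## The `Balance` operator

A worker that has already handed out `d` units of work at a level and now has a list `L` of new
pieces hands out their units as if the units were dealt cyclically over the `w` workers, so every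
worker gets `1 / w` of the work up to a difference of one, now and cumulatively.
First every target gets the same number of uncut pieces among those of at most average work; then
the remaining pieces are laid out in a row and cut greedily so that every target gets exactly its
quota. A target causes at most one cut. -/

/-- How many of the first `d` cyclically dealt units go to target `k`. -/
def share (w d k : ℕ) : ℕ := (d + (w - 1 - k)) / w

/-- The amount of work that target `k` gets out of `L`. -/
def quota {n : ℕ} {V : Type*} (w d : ℕ) (L : List (Piece n V)) (k : ℕ) : ℕ :=
  share w (d + Piece.total L) k - share w d k

/-- The pieces of at most average work. -/
def smallPieces {n : ℕ} {V : Type*} (L : List (Piece n V)) : List (Piece n V) :=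
  L.filter (fun t => t.work * L.length ≤ Piece.total L)

/-- The pieces of more than average work. -/
def largePieces {n : ℕ} {V : Type*} (L : List (Piece n V)) : List (Piece n V) :=
  L.filter (fun t => Piece.total L < t.work * L.length)

/-- The uncut pieces that target `k` gets first. -/
def dealt {n : ℕ} {V : Type*} (w : ℕ) (L : List (Piece n V)) (k : ℕ) : List (Piece n V) :=
  ((smallPieces L).drop (k * ((smallPieces L).length / w))).take ((smallPieces L).length / w)

/-- The work that target `k` still lacks after the uncut pieces. -/
def lacking {n : ℕ} {V : Type*} (w d : ℕ) (L : List (Piece n V)) (k : ℕ) : ℕ :=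
  quota w d L k - Piece.total (dealt w L k)

/-- The pieces that are not dealt uncut. -/
def pool {n : ℕ} {V : Type*} (w : ℕ) (L : List (Piece n V)) : List (Piece n V) :=
  (smallPieces L).drop (w * ((smallPieces L).length / w)) ++ largePieces L

/-- All pieces sent to target `k`. -/
def parcel {n : ℕ} {V : Type*} (w d : ℕ) (L : List (Piece n V)) (k : ℕ) : List (Piece n V) :=
  dealt w L k ++
    Piece.takeWork (lacking w d L k)
      (Piece.dropWork (∑ k' ∈ Finset.range k, lacking w d L k') (pool w L))

/-! ## The state of the computation -/

/-- The state between two batches. -/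
structure State (n : ℕ) (V : Type*) (w : ℕ) where
  /-- the tuples of level `j` (prefix `j`-tuples) stored at each worker -/
  queue : ℕ → Fin w → List (Piece n V)
  /-- the work of level `j` that each worker has handed out so far in `Balance` -/
  given : ℕ → Fin w → ℕ
  /-- the results written to the storage outside the cluster -/
  out : List (List V)

section Algorithm

variable {m n : ℕ} {V : Type*} (D : Instance m n V) {w : ℕ}

/-- The number of tuples of all levels that worker `k` stores. -/
def State.stored (m : ℕ) (S : State n V w) (k : Fin w) : ℕ :=
  ∑ j ∈ Finset.range m, (S.queue j k).length

/-- A distributed look-up in an index. `keys k` lists the keys needed by worker `k`, one for each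
tuple it manages. Each worker aggregates equal keys and sends one request for each distinct key to
the worker holding it; in the next round the answers are sent back and attached to the tuples. -/
def lookupRounds (h : Key n V → Fin w) (stored : Fin w → ℕ) (keys : Fin w → List (Key n V)) :
    List (Round w) :=
  let req : List (Fin w × Fin w) :=
    (List.finRange w).flatMap fun k => (keys k).dedup.map fun κ => (k, h κ)
  [{ msgs := req
     comp := fun k => (keys k).length
     held := fun k => stored k + (keys k).length },
   { msgs := req.map Prod.swap
     comp := fun k => req.countP (fun e => e.2 = k) + (keys k).length
     held := fun k => stored k + (keys k).length }]

/-! ### `Extension-Resolve` -/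

/-- The batch of at most `B'` tuples `(p, k)` of level `j` taken up by a worker. -/
def batch (B' : ℕ) (S : State n V w) (j : ℕ) (k : Fin w) : List (List V × Fin n × ℕ) :=
  (Piece.takeWork B' (S.queue j k)).flatMap Piece.units

/-- The state after the batch has been taken from the queues. -/
def popBatch (B' : ℕ) (S : State n V w) (j : ℕ) : State n V w :=
  { S with queue := Function.update S.queue j fun k => Piece.dropWork B' (S.queue j k) }

/-- The key of the look-up that resolves `(p, k)`. -/
def resolveKey (j : ℕ) (u : List V × Fin n × ℕ) : Key n V :=
  Key.res u.2.1 j (D.proj u.2.1 u.1) u.2.2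

/-- The candidate extension `p • e` where `e` is the extension number `k` of `p`. -/
def resolve (u : List V × Fin n × ℕ) : Option (List V) :=
  ((D.ext u.2.1 u.1).toList[u.2.2]?).map fun e => u.1 ++ [e]

/-! ### `Intersect` -/

/-- The candidate extensions that survive the intersections with a list of relations. -/
def intersect : List (Fin n) → (Fin w → List (List V)) → Fin w → List (List V)
  | [], X => X
  | i :: is, X => intersect is fun k => (X k).filter (fun c => D.InExt i c)

def intersectRounds (h : Key n V → Fin w) (stored : Fin w → ℕ) (j : ℕ) :
    List (Fin n) → (Fin w → List (List V)) → List (Round w)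
  | [], _ => []
  | i :: is, X =>
    lookupRounds h stored (fun k => (X k).map fun c => Key.mem i j (D.proj i c)) ++
      intersectRounds h stored j is fun k => (X k).filter (fun c => D.InExt i c)

/-! ### `Count` -/

/-- Update of `(min-c, min-i)` for the prefix `p` by the relation `i`; `none` is `(∞, ⊥)`. -/
def better (i : Fin n) (p : List V) : Option (ℕ × Fin n) → Option (ℕ × Fin n)
  | none => some ((D.ext i p).card, i)
  | some b => if (D.ext i p).card < b.1 then some ((D.ext i p).card, i) else some b

/-- The value of `(min-c, min-i)` after count minimization over a list of relations. -/
def minCount (is : List (Fin n)) (p : List V) : Option (ℕ × Fin n) :=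
  is.foldl (fun b i => better D i p b) none

/-- The pieces for new prefixes of level `j`; prefixes without extensions are discarded. -/
def newPieces (j : ℕ) (P : List (List V)) : List (Piece n V) :=
  P.filterMap fun p =>
    match minCount D (D.relsAt j) p with
    | none => none
    | some (c, i) => if c = 0 then none else some ⟨p, i, 0, c⟩

def countRounds (h : Key n V → Fin w) (stored : Fin w → ℕ) (j : ℕ)
    (P : Fin w → List (List V)) : List (Round w) :=
  (D.relsAt j).flatMap fun i =>
    lookupRounds h stored fun k => (P k).map fun p => Key.count i j (D.proj i p)

/-! ### `Balance`, and the output of results -/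

/-- The pieces of level `j` that worker `l` sends to worker `k`. -/
def sentPieces (S : State n V w) (j : ℕ) (P : Fin w → List (List V)) (l k : Fin w) :
    List (Piece n V) := parcel w (S.given j l) (newPieces D j (P l)) k

def balanceRound (S : State n V w) (j : ℕ) (P : Fin w → List (List V)) : Round w where
  msgs := (List.finRange w).flatMap fun l => (List.finRange w).flatMap fun k =>
    (sentPieces D S j P l k).map fun _ => (l, k)
  comp := fun k => (P k).length + (∑ l, (sentPieces D S j P k l).length) +
    ∑ l, (sentPieces D S j P l k).length
  held := fun k => S.stored m k + (P k).length

/-- The treatment of new prefixes of level `j`: for `j < m` they pass `Count` and `Balance`;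
for `j = m` they are results and are written out. -/
def settle (S : State n V w) (j : ℕ) (P : Fin w → List (List V)) : State n V w :=
  if j < m then
    { S with
      queue := Function.update S.queue j fun k =>
        S.queue j k ++ (List.finRange w).flatMap fun l => sentPieces D S j P l k
      given := Function.update S.given j fun l =>
        S.given j l + Piece.total (newPieces D j (P l)) }
  else { S with out := S.out ++ (List.finRange w).flatMap P }

def settleRounds (h : Key n V → Fin w) (S : State n V w) (j : ℕ) (P : Fin w → List (List V)) :
    List (Round w) :=
  if j < m then countRounds D h (S.stored m) j P ++ [balanceRound D S j P] else []

/-! ### One batch, and the whole algorithm -/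

variable (w) in
/-- The computation starts from the empty prefix, held by the first worker. -/
def start : Fin w → List (List V) := fun k => if k.val = 0 then [[]] else []

variable (V) (n) (w) in
def emptyState : State n V w := ⟨fun _ _ => [], fun _ _ => 0, []⟩

/-- The candidate extensions of a batch of level `j`. -/
def candidates (B' : ℕ) (S : State n V w) (j : ℕ) (k : Fin w) : List (List V) :=
  (batch B' S j k).filterMap (resolve D)

/-- The effect of a batch that extends prefixes of level `j` to prefixes of level `j + 1`. -/
def extend (B' : ℕ) (S : State n V w) (j : ℕ) : State n V w :=
  settle D (popBatch B' S j) (j + 1) (intersect D (D.relsAt j) (candidates D B' S j))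

def extendRounds (B' : ℕ) (h : Key n V → Fin w) (S : State n V w) (j : ℕ) : List (Round w) :=
  lookupRounds h ((popBatch B' S j).stored m)
      (fun k => (batch B' S j k).map (resolveKey D j)) ++
    intersectRounds D h ((popBatch B' S j).stored m) j (D.relsAt j) (candidates D B' S j) ++
    settleRounds D h (popBatch B' S j) (j + 1)
      (intersect D (D.relsAt j) (candidates D B' S j))

/-- The choice of the level of the next batch: the largest level at which all workers have `B'`
candidate extensions to make; if there is none, the smallest level at which there is something left
(these are the last batches of that level). `none` means that the computation has ended. -/
def nextLevel (m B' : ℕ) (S : State n V w) : Option ℕ :=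
  (((List.range m).filter fun j => ∀ k, B' ≤ Piece.total (S.queue j k)).getLast?).or
    (((List.range m).filter fun j => ∃ k, 0 < Piece.total (S.queue j k)).head?)

variable (w) (B' : ℕ)

/-- The state after `t` batches. -/
def stateAfter : ℕ → State n V w
  | 0 => settle D (emptyState n V w) 0 (start w)
  | t + 1 =>
    match nextLevel m B' (stateAfter t) with
    | none => stateAfter t
    | some j => extend D B' (stateAfter t) j

/-- The number of batches until the computation ends. -/
def numBatches : ℕ := sInf {t | nextLevel m B' (stateAfter D w B' t) = none}

variable {w}

/-- All rounds of the execution of BiGJoin-S, with index entries distributed by `h`. -/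
def rounds (h : Key n V → Fin w) : List (Round w) :=
  settleRounds D h (emptyState n V w) 0 (start w) ++
    (List.range (numBatches D w B')).flatMap fun t =>
      match nextLevel m B' (stateAfter D w B' t) with
      | none => []
      | some j => extendRounds D B' h (stateAfter D w B' t) j

/-! ### Costs of an execution -/

/-- The cumulative communication: the number of tuples received, over all rounds and workers. -/
def communication (h : Key n V → Fin w) : ℕ :=
  ((rounds D B' h).map fun r => ∑ k, r.received k).sum

/-- The cumulative computation, over all rounds and workers. -/
def computation (h : Key n V → Fin w) : ℕ :=
  ((rounds D B' h).map fun r => ∑ k, r.comp k).sum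

/-- The cumulative memory: the maximum over all rounds of the total number of tuples (index
entries included, written results excluded) in the memories of the workers. -/
def memory (h : Key n V → Fin w) : ℕ :=
  ((rounds D B' h).map fun r => ∑ k, (r.held k + r.received k + indexSize D h k)).foldr max 0

/-- The load: the maximum number of tuples that one worker receives in one round. The share of the
input that a worker holds at the beginning (the input being equally distributed) and the index
entries that it gets count as received in preliminary rounds. -/
def load (h : Key n V → Fin w) : ℕ :=
  max ((D.inputSize + w - 1) / w) <|
    max (Finset.univ.sup fun k => indexSize D h k)
      (((rounds D B' h).map fun r => Finset.univ.sup fun k => r.received k).foldr max 0)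

end Algorithm

/-- The largest number of input tuples on one worker when the input is placed on the workers by
`place`; the load of any algorithm that starts from this placement is at least this number. -/
def placementLoad {m n : ℕ} {V : Type*} (D : Instance m n V) {w : ℕ}
    (place : (Σ i : Fin n, {t // t ∈ D.rel i}) → Fin w) : ℕ :=
  Finset.univ.sup fun k => (Finset.univ.filter fun s => place s = k).card

end BiGJoinS

end

noncomputable section

namespace BiGJoinS

open scoped Classical

/-! ## Lists of pieces -/

namespace Piece

variable {n : ℕ} {V : Type*}

/-- The units of work of a list of pieces. -/
def unitList (L : List (Piece n V)) : List (List V × Fin n × ℕ) := L.flatMap units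

@[simp] lemma total_nil : total ([] : List (Piece n V)) = 0 := rfl

@[simp] lemma total_cons (t : Piece n V) (L : List (Piece n V)) :
    total (t :: L) = t.work + total L := by simp [total]

@[simp] lemma total_append (L L' : List (Piece n V)) : total (L ++ L') = total L + total L' := by
  simp [total]

@[simp] lemma length_units (t : Piece n V) : t.units.length = t.work := by simp [units]

lemma length_unitList (L : List (Piece n V)) : (unitList L).length = total L := by
  simp [unitList, total, List.length_flatMap]

@[simp] lemma unitList_nil : unitList ([] : List (Piece n V)) = [] := rfl

@[simp] lemma unitList_cons (t : Piece n V) (L : List (Piece n V)) :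
    unitList (t :: L) = t.units ++ unitList L := rfl

@[simp] lemma unitList_append (L L' : List (Piece n V)) :
    unitList (L ++ L') = unitList L ++ unitList L' := by simp [unitList]

lemma total_perm {L L' : List (Piece n V)} (h : L.Perm L') : total L = total L' :=
  (h.map work).sum_eq

lemma unitList_perm {L L' : List (Piece n V)} (h : L.Perm L') :
    (unitList L).Perm (unitList L') := h.flatMap_right _

lemma unitList_takeWork (b : ℕ) (L : List (Piece n V)) :
    unitList (takeWork b L) = (unitList L).take b := by
  induction L generalizing b with
  | nil => simp [takeWork]
  | cons t L ih =>
    unfold takeWork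
    split_ifs with h0 h1
    · simp [h0]
    · rw [unitList_cons, unitList_cons, ih, List.take_append, length_units,
        List.take_of_length_le (l := t.units) (by simpa using h1)]
    · rw [unitList_cons, unitList_cons, List.take_append_of_le_length (by simp; omega)]
      simp only [unitList_nil, List.append_nil, units, work, add_tsub_cancel_left, ← List.map_take]
      rw [List.take_range'_of_length_ge (by unfold work at h1; omega)]

lemma unitList_dropWork (b : ℕ) (L : List (Piece n V)) :
    unitList (dropWork b L) = (unitList L).drop b := by
  induction L generalizing b with
  | nil => simp [dropWork]
  | cons t L ih =>
    unfold dropWork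
    split_ifs with h1
    · rw [unitList_cons, ih, List.drop_append, length_units,
        List.drop_of_length_le (l := t.units) (by simpa using h1), List.nil_append]
    · rw [unitList_cons, unitList_cons, List.drop_append_of_le_length (by simp; omega)]
      congr 1
      simp only [units, work, ← List.map_drop, List.drop_range']
      congr 2 <;> omega

lemma total_takeWork (b : ℕ) (L : List (Piece n V)) : total (takeWork b L) = min b (total L) := by
  rw [← length_unitList, unitList_takeWork, List.length_take, length_unitList]

lemma total_dropWork (b : ℕ) (L : List (Piece n V)) : total (dropWork b L) = total L - b := by
  rw [← length_unitList, unitList_dropWork, List.length_drop, length_unitList]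

/-- All pieces of the list carry work. -/
def AllPos (L : List (Piece n V)) : Prop := ∀ t ∈ L, 0 < t.work

lemma AllPos.tail {t : Piece n V} {L : List (Piece n V)} (h : AllPos (t :: L)) : AllPos L :=
  fun s hs => h s (List.mem_cons_of_mem _ hs)

lemma AllPos.append {L L' : List (Piece n V)} (h : AllPos L) (h' : AllPos L') :
    AllPos (L ++ L') := fun t ht => (List.mem_append.1 ht).elim (h t) (h' t)

lemma AllPos.subset {L L' : List (Piece n V)} (h : AllPos L) (h' : L' ⊆ L) : AllPos L' :=
  fun t ht => h t (h' ht)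

lemma AllPos.length_le {L : List (Piece n V)} (h : AllPos L) : L.length ≤ total L := by
  induction L with
  | nil => simp
  | cons t L ih =>
    have := h t (by simp)
    have := ih h.tail
    simp only [List.length_cons, total_cons]; omega

lemma AllPos.takeWork {L : List (Piece n V)} (h : AllPos L) (b : ℕ) :
    AllPos (takeWork b L) := by
  induction L generalizing b with
  | nil => simpa [Piece.takeWork] using h
  | cons t L ih =>
    unfold Piece.takeWork
    split_ifs with h0 h1
    · intro s hs; simp at hs
    · intro s hs
      rcases List.mem_cons.1 hs with rfl | hs
      · exact h _ (by simp)
      · exact ih h.tail _ s hs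
    · intro s hs
      obtain rfl := List.mem_singleton.1 hs
      simp only [work] at *; omega

lemma AllPos.dropWork {L : List (Piece n V)} (h : AllPos L) (b : ℕ) :
    AllPos (dropWork b L) := by
  induction L generalizing b with
  | nil => simpa [Piece.dropWork] using h
  | cons t L ih =>
    unfold Piece.dropWork
    split_ifs with h1
    · exact ih h.tail _
    · intro s hs
      rcases List.mem_cons.1 hs with rfl | hs
      · simp only [work] at *; omega
      · exact h.tail s hs

lemma length_dropWork_le (b : ℕ) (L : List (Piece n V)) : (dropWork b L).length ≤ L.length := by
  induction L generalizing b with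
  | nil => simp [dropWork]
  | cons t L ih =>
    unfold dropWork
    split_ifs with h1
    · exact (ih _).trans (by simp)
    · simp

lemma length_takeWork_add (b : ℕ) {L : List (Piece n V)} (h : AllPos L) :
    (takeWork b L).length + (dropWork b L).length ≤ L.length + 1 := by
  induction L generalizing b with
  | nil => simp [takeWork, dropWork]
  | cons t L ih =>
    unfold takeWork dropWork
    have h0 := h t (by simp)
    have h1 := ih (b - t.work) h.tail
    split_ifs <;> simp only [List.length_cons, List.length_nil] <;> omega

lemma dropWork_dropWork (a b : ℕ) {L : List (Piece n V)} (h : AllPos L) :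
    dropWork b (dropWork a L) = dropWork (a + b) L := by
  induction L generalizing a b with
  | nil => simp [dropWork]
  | cons t L ih =>
    have h0 := h t (by simp)
    by_cases h1 : t.work ≤ a
    · rw [dropWork, if_pos h1, ih _ _ h.tail, dropWork, if_pos (by omega)]
      congr 1; omega
    · rw [dropWork, if_neg h1]
      by_cases h2 : t.work ≤ a + b
      · rw [dropWork, if_pos (by simp only [work] at *; omega), dropWork, if_pos h2]
        congr 1; simp only [work] at *; omega
      · rw [dropWork, if_neg (by simp only [work] at *; omega), dropWork, if_neg h2]
        simp [add_assoc]

/-- Cutting a row of pieces successively creates at most one new piece per cut. -/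
lemma sum_length_takeWork_dropWork (f : ℕ → ℕ) {L : List (Piece n V)} (h : AllPos L) (w : ℕ) :
    ∑ k ∈ Finset.range w, (takeWork (f k) (dropWork (∑ k' ∈ Finset.range k, f k') L)).length
      + (dropWork (∑ k' ∈ Finset.range w, f k') L).length ≤ L.length + w := by
  induction w with
  | zero => simpa using length_dropWork_le 0 L
  | succ w ih =>
    rw [Finset.sum_range_succ, Finset.sum_range_succ f, ← dropWork_dropWork _ _ h]
    have := length_takeWork_add (f w) (h.dropWork (∑ k' ∈ Finset.range w, f k'))
    omega

lemma flatMap_take_drop {α : Type*} (f : ℕ → ℕ) (U : List α) (w : ℕ) :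
    (List.range w).flatMap (fun k => (U.drop (∑ k' ∈ Finset.range k, f k')).take (f k))
      = U.take (∑ k ∈ Finset.range w, f k) := by
  induction w with
  | zero => simp
  | succ w ih =>
    rw [List.range_succ, List.flatMap_append, ih, Finset.sum_range_succ, List.take_add]
    simp

/-- The number of pieces of a row that are needed for `b` units of work, when few of the pieces
have less work than `T / N`. -/
lemma length_takeWork_mul_le (N T b : ℕ) (L : List (Piece n V)) :
    (takeWork b L).length * T ≤ b * N + (1 + L.countP (fun t => ¬ T < t.work * N)) * T := by
  induction L generalizing b with
  | nil => simp [takeWork]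
  | cons t L ih =>
    unfold takeWork
    split_ifs with h0 h1
    · simp
    · have := ih (b - t.work)
      obtain ⟨c, rfl⟩ := Nat.exists_eq_add_of_le h1
      rw [Nat.add_sub_cancel_left] at this
      rw [List.length_cons, List.countP_cons, Nat.add_sub_cancel_left]
      split_ifs with h2
      · nlinarith
      · have h3 : T < t.work * N := by simpa using h2
        nlinarith
    · simp only [List.length_singleton]; nlinarith

lemma countP_dropWork_le (p : Piece n V → Bool) (b : ℕ) (L : List (Piece n V)) :
    (dropWork b L).countP p ≤ L.countP p + 1 := by
  induction L generalizing b with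
  | nil => simp [dropWork]
  | cons t L ih =>
    unfold dropWork
    split_ifs with h1
    · have := ih (b - t.work)
      rw [List.countP_cons]; omega
    · rw [List.countP_cons, List.countP_cons]
      split_ifs <;> omega

end Piece

/-! ## The `Balance` operator -/

open Piece

section Balance

variable {n : ℕ} {V : Type*}

lemma share_succ {w : ℕ} (hw : 0 < w) (d : ℕ) {k : ℕ} (hk : k < w) :
    share w (d + 1) k = share w d k + if k = d % w then 1 else 0 := by
  unfold share
  have h1 : d + 1 + (w - 1 - k) = (d + (w - 1 - k)) + 1 := by ring
  rw [h1, Nat.succ_div]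
  congr 1
  have hd := Nat.div_add_mod d w
  have hm := Nat.mod_lt d hw
  by_cases h : k = d % w
  · rw [if_pos h, if_pos]
    refine ⟨d / w + 1, ?_⟩
    rw [mul_add]; omega
  · rw [if_neg h, if_neg]
    rintro ⟨c, hc⟩
    apply h
    have h2 : d = w * c + k - w := by omega
    rcases c with _ | c
    · rw [mul_zero] at hc; omega
    · rw [mul_add, mul_one] at h2
      have h3 : d = k + w * c := by omega
      rw [h3, Nat.add_mul_mod_self_left, Nat.mod_eq_of_lt hk]

lemma sum_share {w : ℕ} (hw : 0 < w) (d : ℕ) : ∑ k ∈ Finset.range w, share w d k = d := by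
  induction d with
  | zero =>
    refine Finset.sum_eq_zero fun k hk => ?_
    unfold share
    exact Nat.div_eq_of_lt (by omega)
  | succ d ih =>
    rw [Finset.sum_congr rfl (fun k hk => share_succ hw d (Finset.mem_range.1 hk)),
      Finset.sum_add_distrib, ih, Finset.sum_ite_eq']
    rw [if_pos (Finset.mem_range.2 (Nat.mod_lt d hw))]

lemma share_mono (w k : ℕ) {d d' : ℕ} (h : d ≤ d') : share w d k ≤ share w d' k :=
  Nat.div_le_div_right (by omega)

lemma share_le_share_add_one {w : ℕ} (d : ℕ) (k k' : ℕ) (hk' : k' < w) :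
    share w d k ≤ share w d k' + 1 := by
  unfold share
  rw [← Nat.add_div_right _ (by omega)]
  exact Nat.div_le_div_right (by omega)

lemma share_add_quota (w d : ℕ) (L : List (Piece n V)) (k : ℕ) :
    share w d k + quota w d L k = share w (d + total L) k := by
  unfold quota
  have := share_mono w k (Nat.le_add_right d (total L))
  omega

lemma sum_quota {w : ℕ} (hw : 0 < w) (d : ℕ) (L : List (Piece n V)) :
    ∑ k ∈ Finset.range w, quota w d L k = total L := by
  have h := sum_share hw (d + total L)
  rw [← Finset.sum_congr rfl (fun k _ => share_add_quota w d L k), Finset.sum_add_distrib,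
    sum_share hw] at h
  omega

lemma quota_ge {w : ℕ} (d : ℕ) (L : List (Piece n V)) (k : ℕ) :
    total L / w ≤ quota w d L k := by
  unfold quota share
  have : (d + (w - 1 - k)) / w + total L / w ≤ (d + total L + (w - 1 - k)) / w := by
    rw [show d + total L + (w - 1 - k) = (d + (w - 1 - k)) + total L by ring]
    exact Nat.div_add_div_le_add_div
  omega

lemma quota_mul_le {w : ℕ} (hw : 0 < w) (d : ℕ) (L : List (Piece n V)) (k : ℕ) :
    w * quota w d L k ≤ total L + w := by
  unfold quota share
  have h1 := Nat.div_add_mod (d + (w - 1 - k)) w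
  have h2 := Nat.mod_lt (d + (w - 1 - k)) hw
  have h3 := Nat.mul_div_le (d + total L + (w - 1 - k)) w
  rw [Nat.mul_sub]; omega

lemma total_le_mul_length {L : List (Piece n V)} {N T : ℕ} (h : ∀ t ∈ L, t.work * N ≤ T) :
    total L * N ≤ L.length * T := by
  induction L with
  | nil => simp
  | cons t L ih =>
    have h1 := h t (by simp)
    have h2 := ih fun s hs => h s (List.mem_cons_of_mem _ hs)
    rw [total_cons, List.length_cons]; nlinarith

lemma length_dealt_le (w : ℕ) (L : List (Piece n V)) (k : ℕ) :
    w * (dealt w L k).length ≤ L.length := by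
  unfold dealt
  calc _ ≤ w * ((smallPieces L).length / w) := Nat.mul_le_mul_left _ (List.length_take_le _ _)
    _ ≤ (smallPieces L).length := Nat.mul_div_le _ _
    _ ≤ _ := List.length_filter_le _ _

lemma dealt_subset (w : ℕ) (L : List (Piece n V)) (k : ℕ) : dealt w L k ⊆ smallPieces L :=
  fun _ ht => List.drop_subset _ _ (List.take_subset _ _ ht)

lemma total_dealt_le_quota {w : ℕ} (hw : 0 < w) (d : ℕ) (L : List (Piece n V)) (k : ℕ) :
    total (dealt w L k) ≤ quota w d L k := by
  refine le_trans ?_ (quota_ge d L k)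
  rw [Nat.le_div_iff_mul_le hw]
  rcases Nat.eq_zero_or_pos L.length with h0 | h0
  · rw [List.length_eq_zero_iff] at h0
    subst h0
    simp [dealt, smallPieces]
  · have h1 : total (dealt w L k) * L.length ≤ (dealt w L k).length * total L :=
      total_le_mul_length fun t ht => by
        have := dealt_subset w L k ht
        simpa [smallPieces] using (List.mem_filter.1 this).2
    have h2 := length_dealt_le w L k
    refine Nat.le_of_mul_le_mul_right ?_ h0
    nlinarith

lemma small_perm (L : List (Piece n V)) : (smallPieces L ++ largePieces L).Perm L := by
  have h := List.filter_append_perm (fun t : Piece n V => t.work * L.length ≤ total L) L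
  have h2 : largePieces L = L.filter fun t => !decide (t.work * L.length ≤ total L) :=
    List.filter_congr fun t _ => by
      rw [← decide_not]
      exact decide_eq_decide.2 not_le.symm
  rw [h2]
  exact h

lemma flatMap_dealt (w : ℕ) (L : List (Piece n V)) :
    (List.range w).flatMap (dealt w L)
      = (smallPieces L).take (w * ((smallPieces L).length / w)) := by
  have := flatMap_take_drop (fun _ => (smallPieces L).length / w) (smallPieces L) w
  simp only [Finset.sum_const, Finset.card_range, smul_eq_mul] at this
  exact this

lemma dealt_pool_perm (w : ℕ) (L : List (Piece n V)) :
    ((List.range w).flatMap (dealt w L) ++ pool w L).Perm L := by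
  rw [flatMap_dealt, pool, ← List.append_assoc, List.take_append_drop]
  exact small_perm L

lemma sum_range_map_flatMap {α β : Type*} [AddCommMonoid β] (g : List α → β) (h0 : g [] = 0)
    (hg : ∀ a b, g (a ++ b) = g a + g b) (f : ℕ → List α) (w : ℕ) :
    g ((List.range w).flatMap f) = ∑ k ∈ Finset.range w, g (f k) := by
  induction w with
  | zero => simpa using h0
  | succ w ih => rw [List.range_succ, List.flatMap_append, hg, ih, Finset.sum_range_succ]; simp

lemma sum_lacking {w : ℕ} (hw : 0 < w) (d : ℕ) (L : List (Piece n V)) :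
    ∑ k ∈ Finset.range w, lacking w d L k = total (pool w L) := by
  have h1 := total_perm (dealt_pool_perm w L)
  rw [total_append, sum_range_map_flatMap total rfl total_append] at h1
  have h2 := sum_quota hw d L
  have h3 : ∑ k ∈ Finset.range w, quota w d L k = ∑ k ∈ Finset.range w, lacking w d L k +
      ∑ k ∈ Finset.range w, total (dealt w L k) := by
    rw [← Finset.sum_add_distrib]
    refine Finset.sum_congr rfl fun k _ => ?_
    have := total_dealt_le_quota hw d L k
    unfold lacking; omega
  omega

lemma unitList_parcel (w d : ℕ) (L : List (Piece n V)) (k : ℕ) :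
    unitList (parcel w d L k) = unitList (dealt w L k) ++
      ((unitList (pool w L)).drop (∑ k' ∈ Finset.range k, lacking w d L k')).take
        (lacking w d L k) := by
  rw [parcel, unitList_append, unitList_takeWork, unitList_dropWork]

/-- `Balance` hands out every unit of work exactly once. -/
lemma unitList_parcel_perm {w : ℕ} (hw : 0 < w) (d : ℕ) (L : List (Piece n V)) :
    ((List.range w).flatMap fun k => unitList (parcel w d L k)).Perm (unitList L) := by
  have h1 : ((List.range w).flatMap fun k => unitList (parcel w d L k)).Perm
      ((List.range w).flatMap (fun k => unitList (dealt w L k)) ++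
        (List.range w).flatMap fun k =>
          ((unitList (pool w L)).drop (∑ k' ∈ Finset.range k, lacking w d L k')).take
            (lacking w d L k)) := by
    simp only [unitList_parcel]
    exact (List.flatMap_append_perm _ _ _).symm
  refine h1.trans ?_
  rw [flatMap_take_drop, sum_lacking hw, ← length_unitList, List.take_length]
  have h2 := unitList_perm (dealt_pool_perm w L)
  rw [unitList_append] at h2
  convert h2 using 2
  rw [unitList, List.flatMap_assoc]
  rfl

lemma total_parcel {w : ℕ} (hw : 0 < w) (d : ℕ) (L : List (Piece n V)) {k : ℕ} (hk : k < w) :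
    total (parcel w d L k) = quota w d L k := by
  have h1 := sum_lacking hw d L
  have h2 : ∑ k' ∈ Finset.range (k + 1), lacking w d L k' ≤ total (pool w L) := by
    rw [← h1]
    exact Finset.sum_le_sum_of_subset (Finset.range_mono hk)
  rw [Finset.sum_range_succ] at h2
  have h3 := total_dealt_le_quota hw d L k
  rw [parcel, total_append, total_takeWork, total_dropWork, min_eq_left (by omega)]
  unfold lacking; omega

lemma pool_subset (w : ℕ) (L : List (Piece n V)) : pool w L ⊆ L := by
  intro t ht
  exact (dealt_pool_perm w L).subset (List.mem_append_right _ ht)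

lemma allPos_parcel (w d : ℕ) {L : List (Piece n V)} (hL : AllPos L) (k : ℕ) :
    AllPos (parcel w d L k) := by
  refine AllPos.append (hL.subset ?_) (((hL.subset (pool_subset w L)).dropWork _).takeWork _)
  exact fun t ht => (List.mem_filter.1 (dealt_subset w L k ht)).1

/-- A target causes at most one cut. -/
lemma sum_length_parcel_le (w d : ℕ) {L : List (Piece n V)} (hL : AllPos L) :
    ∑ k ∈ Finset.range w, (parcel w d L k).length ≤ L.length + w := by
  have h1 := sum_length_takeWork_dropWork (lacking w d L) (hL.subset (pool_subset w L)) w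
  have h2 := (dealt_pool_perm w L).length_eq
  rw [List.length_append, sum_range_map_flatMap List.length rfl (by simp)] at h2
  simp only [parcel, List.length_append, Finset.sum_add_distrib]
  omega

lemma countP_pool_le {w : ℕ} (hw : 0 < w) (L : List (Piece n V)) :
    (pool w L).countP (fun t => ¬ total L < t.work * L.length) ≤ w := by
  rw [pool, List.countP_append]
  have h1 : (largePieces L).countP (fun t => ¬ total L < t.work * L.length) = 0 := by
    rw [List.countP_eq_zero]
    intro t ht
    have := (List.mem_filter.1 ht).2
    simpa using this
  rw [h1, add_zero]
  refine List.countP_le_length.trans ?_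
  rw [List.length_drop]
  have h2 := Nat.div_add_mod (smallPieces L).length w
  have h3 := Nat.mod_lt (smallPieces L).length hw
  omega

/-- No target gets much more than its share of the pieces of a sender. -/
lemma length_parcel_mul_le {w : ℕ} (hw : 0 < w) (d : ℕ) {L : List (Piece n V)} (hL : AllPos L)
    (k : ℕ) : w * (parcel w d L k).length ≤ 2 * L.length + w * w + 3 * w := by
  rcases Nat.eq_zero_or_pos L.length with h0 | h0
  · rw [List.length_eq_zero_iff] at h0
    subst h0
    simp [parcel, dealt, pool, smallPieces, largePieces, dropWork, takeWork]
  have hT : L.length ≤ total L := hL.length_le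
  have h3 := countP_pool_le hw L
  set T := total L with hTdef
  set s := ∑ k' ∈ Finset.range k, lacking w d L k'
  set X := takeWork (lacking w d L k) (dropWork s (pool w L)) with hX
  have h1 := length_takeWork_mul_le L.length T (lacking w d L k) (dropWork s (pool w L))
  have h2 := countP_dropWork_le (fun t => ¬ T < t.work * L.length) s (pool w L)
  have h4 : w * lacking w d L k ≤ T + w :=
    (Nat.mul_le_mul_left w (Nat.sub_le _ _)).trans (quota_mul_le hw d L k)
  rw [← hX] at h1
  have h5 : X.length * T ≤ lacking w d L k * L.length + (w + 2) * T :=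
    h1.trans (Nat.add_le_add_left (Nat.mul_le_mul_right _ (by omega)) _)
  have h6 : w * X.length ≤ L.length + w + w * (w + 2) := by
    refine Nat.le_of_mul_le_mul_right ?_ (lt_of_lt_of_le h0 hT)
    calc w * X.length * T = w * (X.length * T) := by ring
      _ ≤ w * (lacking w d L k * L.length + (w + 2) * T) := Nat.mul_le_mul_left _ h5
      _ = (w * lacking w d L k) * L.length + w * (w + 2) * T := by ring
      _ ≤ (T + w) * L.length + w * (w + 2) * T :=
        Nat.add_le_add_right (Nat.mul_le_mul_right _ h4) _
      _ ≤ _ := by nlinarith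
  have h7 := length_dealt_le w L k
  rw [parcel, List.length_append, mul_add, ← hX]
  nlinarith

end Balance

/-! ## Extension sets and matching tuples -/

section Matching

variable {m n : ℕ} {V : Type*} (D : Instance m n V)

/-- The tuples of `R_i` that match the prefix `p`. -/
def matching (i : Fin n) (p : List V) : Finset ({a // a ∈ D.attrs i} → V) :=
  (D.rel i).filter fun t => D.restrict i p.length t = D.proj i p

lemma inExt_iff (i : Fin n) (c : List V) : D.InExt i c ↔ 0 < (matching D i c).card := by
  rw [Finset.card_pos, matching, Finset.filter_nonempty_iff]
  simp [Instance.InExt, Instance.prefixes]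

lemma restrict_succ_of_not_binds {i : Fin n} {j : ℕ} (h : ¬ D.Binds i j)
    (t : {a // a ∈ D.attrs i} → V) : D.restrict i (j + 1) t = D.restrict i j t := by
  funext a
  unfold Instance.restrict
  rcases lt_trichotomy a j with h1 | rfl | h1
  · rw [if_pos (by omega), if_pos h1]
  · rw [if_pos (by omega), if_neg (by omega), Instance.value, dif_neg h]
  · rw [if_neg (by omega), if_neg (by omega)]

lemma proj_snoc_of_not_binds {i : Fin n} {p : List V} (h : ¬ D.Binds i p.length) (e : V) :
    D.proj i (p ++ [e]) = D.proj i p := by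
  funext a
  unfold Instance.proj
  split_ifs with ha
  · rcases lt_trichotomy a p.length with h1 | rfl | h1
    · rw [List.getElem?_append_left h1]
    · exact absurd ha h
    · rw [List.getElem?_eq_none (by simp; omega), List.getElem?_eq_none (by omega)]
  · rfl

lemma restrict_snoc_iff {i : Fin n} {p : List V} (h : D.Binds i p.length) (e : V)
    (t : {a // a ∈ D.attrs i} → V) :
    D.restrict i (p ++ [e]).length t = D.proj i (p ++ [e]) ↔
      D.restrict i p.length t = D.proj i p ∧ D.value i t p.length = some e := by
  rw [List.length_append, List.length_singleton]
  constructor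
  · intro H
    refine ⟨?_, ?_⟩
    · funext a
      have Ha := congrFun H a
      unfold Instance.restrict Instance.proj at *
      by_cases h1 : a < p.length
      · rw [if_pos (by omega), List.getElem?_append_left h1] at Ha
        rw [if_pos h1, Ha]
      · rw [if_neg h1, List.getElem?_eq_none (by omega)]; simp
    · have Ha := congrFun H p.length
      unfold Instance.restrict Instance.proj at Ha
      rw [if_pos (by omega), if_pos h] at Ha
      simpa using Ha
  · rintro ⟨H, H'⟩
    funext a
    have Ha := congrFun H a
    unfold Instance.restrict Instance.proj at *
    rcases lt_trichotomy a p.length with h1 | rfl | h1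
    · rw [if_pos h1] at Ha
      rw [if_pos (by omega), Ha, List.getElem?_append_left h1]
    · rw [if_pos (by omega), if_pos h, H']; simp
    · rw [if_neg (by omega), List.getElem?_eq_none (by simp; omega)]; simp

lemma matching_snoc_of_not_binds {i : Fin n} {p : List V} (h : ¬ D.Binds i p.length) (e : V) :
    matching D i (p ++ [e]) = matching D i p := by
  unfold matching
  rw [proj_snoc_of_not_binds D h, List.length_append, List.length_singleton]
  refine Finset.filter_congr fun t _ => ?_
  rw [restrict_succ_of_not_binds D h]

lemma matching_snoc {i : Fin n} {p : List V} (h : D.Binds i p.length) (e : V) :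
    matching D i (p ++ [e]) = (matching D i p).filter fun t => D.value i t p.length = some e := by
  unfold matching
  rw [Finset.filter_filter]
  exact Finset.filter_congr fun t _ => restrict_snoc_iff D h e t

lemma sum_card_matching_snoc_le {i : Fin n} {p : List V} (h : D.Binds i p.length)
    (E : Finset V) : ∑ e ∈ E, (matching D i (p ++ [e])).card ≤ (matching D i p).card := by
  rw [← Finset.card_biUnion]
  · refine Finset.card_le_card (Finset.biUnion_subset.2 fun e _ => ?_)
    rw [matching_snoc D h]
    exact Finset.filter_subset _ _
  · intro e _ e' _ hne
    rw [Function.onFun, matching_snoc D h, matching_snoc D h, Finset.disjoint_filter]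
    intro t _ h1 h2
    rw [h1] at h2
    exact hne (Option.some.inj h2)

lemma card_ext_le (i : Fin n) (p : List V) : (D.ext i p).card ≤ (matching D i p).card := by
  unfold Instance.ext Instance.extOf matching
  refine Finset.card_biUnion_le.trans ?_
  refine (Finset.sum_le_card_nsmul _ _ 1 fun t _ => ?_).trans (by simp)
  cases D.value i t p.length <;> simp

lemma mem_ext_iff (i : Fin n) (p : List V) (e : V) :
    e ∈ D.ext i p ↔ D.Binds i p.length ∧ D.InExt i (p ++ [e]) := by
  rw [inExt_iff, Finset.card_pos]
  constructor
  · intro h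
    unfold Instance.ext Instance.extOf at h
    obtain ⟨t, ht, h1⟩ := Finset.mem_biUnion.1 h
    rw [Option.mem_toFinset, Option.mem_def] at h1
    have hb : D.Binds i p.length := by
      by_contra hb
      rw [Instance.value, dif_neg hb] at h1
      exact Option.some_ne_none _ h1.symm
    refine ⟨hb, t, ?_⟩
    rw [matching_snoc D hb, Finset.mem_filter]
    exact ⟨ht, h1⟩
  · rintro ⟨hb, t, ht⟩
    rw [matching_snoc D hb, Finset.mem_filter] at ht
    unfold Instance.ext Instance.extOf
    exact Finset.mem_biUnion.2 ⟨t, ht.1, by simp [ht.2]⟩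

lemma mem_relsAt (i : Fin n) (j : ℕ) : i ∈ D.relsAt j ↔ D.Binds i j := by
  simp [Instance.relsAt]

lemma length_relsAt_le (j : ℕ) : (D.relsAt j).length ≤ n :=
  (List.length_filter_le _ _).trans (by simp)

lemma relsAt_ne_nil (hD : D.Covered) {j : ℕ} (hj : j < m) : D.relsAt j ≠ [] := by
  obtain ⟨i, hi⟩ := hD ⟨j, hj⟩
  exact List.ne_nil_of_mem ((mem_relsAt D i j).2 ⟨hj, hi⟩)

/-! ## Count minimization -/

lemma foldl_better (p : List V) (is : List (Fin n)) (b : ℕ × Fin n) :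
    ∃ b', is.foldl (fun b i => better D i p b) (some b) = some b' ∧ b'.1 ≤ b.1 ∧
      (b' = b ∨ ∃ i ∈ is, b' = ((D.ext i p).card, i)) ∧ ∀ i ∈ is, b'.1 ≤ (D.ext i p).card := by
  induction is generalizing b with
  | nil => exact ⟨b, rfl, le_rfl, Or.inl rfl, by simp⟩
  | cons i is ih =>
    rw [List.foldl_cons, better]
    split_ifs with h
    · obtain ⟨b', h1, h2, h3, h4⟩ := ih ((D.ext i p).card, i)
      refine ⟨b', h1, h2.trans h.le, Or.inr ?_, ?_⟩
      · rcases h3 with h3 | ⟨i', hi', h3⟩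
        · exact ⟨i, by simp, h3⟩
        · exact ⟨i', by simp [hi'], h3⟩
      · intro i' hi'
        rcases List.mem_cons.1 hi' with rfl | hi'
        · exact h2
        · exact h4 i' hi'
    · obtain ⟨b', h1, h2, h3, h4⟩ := ih b
      refine ⟨b', h1, h2, ?_, ?_⟩
      · rcases h3 with h3 | ⟨i', hi', h3⟩
        · exact Or.inl h3
        · exact Or.inr ⟨i', by simp [hi'], h3⟩
      · intro i' hi'
        rcases List.mem_cons.1 hi' with rfl | hi'
        · omega
        · exact h4 i' hi'

lemma minCount_spec (p : List V) {is : List (Fin n)} (h : is ≠ []) :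
    ∃ i₀ ∈ is, minCount D is p = some ((D.ext i₀ p).card, i₀) ∧
      ∀ i ∈ is, (D.ext i₀ p).card ≤ (D.ext i p).card := by
  cases is with
  | nil => exact absurd rfl h
  | cons i is =>
    obtain ⟨b', h1, h2, h3, h4⟩ := foldl_better D p is ((D.ext i p).card, i)
    unfold minCount
    rw [List.foldl_cons, better, h1]
    rcases h3 with rfl | ⟨i', hi', rfl⟩
    · exact ⟨i, by simp, rfl, by simpa using h4⟩
    · exact ⟨i', by simp [hi'], rfl, by simpa using ⟨h2, h4⟩⟩

/-- The units of work that a new prefix `p` of level `j` stands for. -/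
def unitsAt (j : ℕ) (p : List V) : List (List V × Fin n × ℕ) := unitList (newPieces D j [p])

/-- The units of work that new prefixes of level `j` stand for. -/
def levelUnits (j : ℕ) (A : Multiset (List V)) : Multiset (List V × Fin n × ℕ) :=
  A.bind fun p => Multiset.ofList (unitsAt D j p)

lemma unitList_newPieces (j : ℕ) (P : List (List V)) :
    unitList (newPieces D j P) = P.flatMap (unitsAt D j) := by
  induction P with
  | nil => rfl
  | cons p P ih =>
    rw [List.flatMap_cons, ← ih, unitsAt, ← unitList_append]
    congr 1
    unfold newPieces
    rw [← List.filterMap_append]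
    rfl

lemma length_newPieces_le (j : ℕ) (P : List (List V)) : (newPieces D j P).length ≤ P.length :=
  List.length_filterMap_le _ _

lemma allPos_newPieces (j : ℕ) (P : List (List V)) : AllPos (newPieces D j P) := by
  intro t ht
  unfold newPieces at ht
  obtain ⟨p, -, hp⟩ := List.mem_filterMap.1 ht
  cases h : minCount D (D.relsAt j) p with
  | none => simp [h] at hp
  | some b =>
    simp only [h] at hp
    split_ifs at hp with h0
    obtain rfl := Option.some.inj hp
    simp only [work]; omega

lemma unitsAt_eq (hD : D.Covered) {j : ℕ} (hj : j < m) (p : List V) :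
    ∃ i₀, D.Binds i₀ j ∧ (∀ i, D.Binds i j → (D.ext i₀ p).card ≤ (D.ext i p).card) ∧
      unitsAt D j p = (List.range (D.ext i₀ p).card).map fun k => (p, i₀, k) := by
  obtain ⟨i₀, h1, h2, h3⟩ := minCount_spec D p (relsAt_ne_nil D hD hj)
  refine ⟨i₀, (mem_relsAt D _ _).1 h1, fun i hi => h3 i ((mem_relsAt D _ _).2 hi), ?_⟩
  unfold unitsAt newPieces
  rw [List.filterMap_cons, h2]
  by_cases h0 : (D.ext i₀ p).card = 0
  · simp [h0]
  · simp [h0, units, work, List.range_eq_range']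

/-- The candidate of a unit of work, if it survives the intersections. -/
def child (j : ℕ) (u : List V × Fin n × ℕ) : Option (List V) :=
  (resolve D u).filter fun c => ∀ i ∈ D.relsAt j, D.InExt i c

lemma filterMap_child (hD : D.Covered) {j : ℕ} (hj : j < m) {p : List V} (hp : p.length = j) :
    ∃ E : Finset V, (∀ e, e ∈ E ↔ ∀ i, D.Binds i j → D.InExt i (p ++ [e])) ∧
      (((unitsAt D j p).filterMap (child D j) : List (List V)) : Multiset (List V)) =
        E.val.map fun e => p ++ [e] := by
  obtain ⟨i₀, h1, -, h3⟩ := unitsAt_eq D hD hj p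
  refine ⟨(D.ext i₀ p).filter fun e => ∀ i, D.Binds i j → D.InExt i (p ++ [e]), ?_, ?_⟩
  · intro e
    rw [Finset.mem_filter, mem_ext_iff, hp]
    exact ⟨fun h => h.2, fun h => ⟨⟨h1, h _ h1⟩, h⟩⟩
  · have h4 : (unitsAt D j p).filterMap (resolve D)
        = (D.ext i₀ p).toList.map fun e => p ++ [e] := by
      rw [h3, List.filterMap_map]
      have h5 : ∀ L : List V, (List.range L.length).filterMap
          (fun k => (L[k]?).map fun e => p ++ [e]) = L.map fun e => p ++ [e] := by
        intro L
        induction L using List.reverseRecOn with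
        | nil => rfl
        | append_singleton L e ih =>
          rw [List.length_append, List.length_singleton, List.range_succ, List.filterMap_append,
            List.map_append]
          congr 1
          · rw [← ih]
            refine List.filterMap_congr fun k hk => ?_
            rw [List.getElem?_append_left (List.mem_range.1 hk)]
          · simp
      rw [← h5, Finset.length_toList]
      rfl
    have h6 : (unitsAt D j p).filterMap (child D j) =
        ((unitsAt D j p).filterMap (resolve D)).filter
          fun c => ∀ i ∈ D.relsAt j, D.InExt i c := by
      rw [List.filter_filterMap]
      rfl
    have h7 : (D.ext i₀ p).toList.filter
        ((fun c => decide (∀ i ∈ D.relsAt j, D.InExt i c)) ∘ fun e => p ++ [e]) =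
        (D.ext i₀ p).toList.filter fun e => ∀ i, D.Binds i j → D.InExt i (p ++ [e]) :=
      List.filter_congr fun e _ => by simp [mem_relsAt]
    rw [h6, h4, List.filter_map, h7, Finset.filter_val, ← Multiset.map_coe, ← Multiset.filter_coe,
      Finset.coe_toList]

/-! ## The prefixes of each level -/

/-- The prefixes of level `j` that are reached by the computation. -/
def reach : ℕ → Multiset (List V)
  | 0 => {[]}
  | j + 1 => (reach j).bind fun p => ((unitsAt D j p).filterMap (child D j) : List (List V))

lemma inExt_nil (hR : ∀ i, (D.rel i).Nonempty) (i : Fin n) : D.InExt i [] := by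
  obtain ⟨t, ht⟩ := hR i
  refine Finset.mem_image.2 ⟨t, ht, ?_⟩
  funext a
  simp [Instance.restrict, Instance.proj]

lemma reach_spec (hD : D.Covered) (hR : ∀ i, (D.rel i).Nonempty) {j : ℕ} (hj : j ≤ m) :
    (reach D j).Nodup ∧ ∀ p ∈ reach D j, p.length = j ∧ ∀ i, D.InExt i p := by
  induction j with
  | zero =>
    refine ⟨Multiset.nodup_singleton _, fun p hp => ?_⟩
    obtain rfl := Multiset.mem_singleton.1 hp
    exact ⟨rfl, inExt_nil D hR⟩
  | succ j ih =>
    obtain ⟨ih1, ih2⟩ := ih (by omega)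
    refine ⟨?_, ?_⟩
    · rw [reach, Multiset.nodup_bind]
      refine ⟨fun p hp => ?_, ?_⟩
      · obtain ⟨E, -, hE⟩ := filterMap_child D hD (j := j) (by omega) (ih2 p hp).1
        rw [hE]
        exact E.nodup.map fun a b hab => by simpa using hab
      · refine ih1.pairwise fun p hp q hq hpq => ?_
        obtain ⟨E, -, hE⟩ := filterMap_child D hD (j := j) (by omega) (ih2 p hp).1
        obtain ⟨F, -, hF⟩ := filterMap_child D hD (j := j) (by omega) (ih2 q hq).1
        rw [Function.onFun, hE, hF, Multiset.disjoint_left]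
        intro c hc hc'
        obtain ⟨e, -, rfl⟩ := Multiset.mem_map.1 hc
        obtain ⟨f, -, hf⟩ := Multiset.mem_map.1 hc'
        exact hpq (List.append_inj_left' hf rfl).symm
    · intro c hc
      obtain ⟨p, hp, hc⟩ := Multiset.mem_bind.1 hc
      obtain ⟨hp1, hp2⟩ := ih2 p hp
      obtain ⟨E, hE', hE⟩ := filterMap_child D hD (j := j) (by omega) hp1
      rw [hE] at hc
      obtain ⟨e, he, rfl⟩ := Multiset.mem_map.1 hc
      refine ⟨by simp [hp1], fun i => ?_⟩
      by_cases hb : D.Binds i j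
      · exact (hE' e).1 he i hb
      · rw [inExt_iff, matching_snoc_of_not_binds D (by rwa [hp1]), ← inExt_iff]
        exact hp2 i

lemma take_mem_reach (hD : D.Covered) {x : Fin m → V}
    (hx : D.IsResult x) {j : ℕ} (hj : j ≤ m) : (List.ofFn x).take j ∈ reach D j := by
  induction j with
  | zero => simp [reach]
  | succ j ih =>
    have h1 := ih (by omega)
    have hl : ((List.ofFn x).take j).length = j := by simp; omega
    refine Multiset.mem_bind.2 ⟨_, h1, ?_⟩
    obtain ⟨E, hE', hE⟩ := filterMap_child D hD (j := j) (by omega) hl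
    rw [hE]
    refine Multiset.mem_map.2 ⟨x ⟨j, hj⟩, (hE' _).2 fun i hi => ?_, ?_⟩
    · refine Finset.mem_image.2 ⟨_, hx i, ?_⟩
      funext a
      unfold Instance.restrict Instance.proj Instance.value
      rw [List.length_append, hl, List.length_singleton]
      by_cases hb : D.Binds i a
      · rw [dif_pos hb, if_pos hb]
        rcases lt_trichotomy a j with h2 | rfl | h2
        · rw [if_pos (by omega), List.getElem?_append_left (by omega), List.getElem?_take_of_lt h2,
            List.getElem?_ofFn, dif_pos hb.1]
        · rw [if_pos (by omega), List.getElem?_append_right (by omega), hl]; simp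
        · rw [if_neg (by omega), List.getElem?_eq_none (by simp; omega)]
      · simp [hb]
    · rw [List.take_add_one, List.getElem?_ofFn, dif_pos (by omega)]
      rfl

lemma mem_reach_iff (hD : D.Covered) (hR : ∀ i, (D.rel i).Nonempty) (p : List V) :
    p ∈ reach D m ↔ ∃ x : Fin m → V, D.IsResult x ∧ p = List.ofFn x := by
  constructor
  · intro hp
    obtain ⟨h1, h2⟩ := (reach_spec D hD hR le_rfl).2 p hp
    subst h1
    refine ⟨fun a => p.get a, fun i => ?_, by simp⟩
    obtain ⟨t, ht, hti⟩ := Finset.mem_image.1 (h2 i)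
    convert ht using 1
    funext a
    have hb : D.Binds i a.1 := ⟨a.1.2, a.2⟩
    have := congrFun hti a.1
    unfold Instance.restrict Instance.proj Instance.value at this
    rw [if_pos a.1.2, dif_pos hb, if_pos hb, List.getElem?_eq_getElem a.1.2] at this
    exact (Option.some.inj this).symm
  · rintro ⟨x, hx, rfl⟩
    have := take_mem_reach D hD hx le_rfl
    rwa [List.take_of_length_le (by simp)] at this

/-! ## The AGM bound -/

lemma one_le_prod_of_one_le {ι : Type*} (s : Finset ι) {f : ι → ℝ} (h : ∀ i ∈ s, 1 ≤ f i) :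
    1 ≤ ∏ i ∈ s, f i := by
  simpa using Finset.prod_le_prod (s := s) (f := fun _ => (1 : ℝ)) (fun _ _ => zero_le_one) h

lemma sum_prod_rpow_le {ι ε : Type*} (s : Finset ι) (E : Finset ε) (x : ι → ℝ)
    (hx : ∀ i, 0 ≤ x i) (hs : 1 ≤ ∑ i ∈ s, x i) (a : ι → ε → ℝ) (S : ι → ℝ)
    (ha : ∀ i ∈ s, ∀ e ∈ E, 0 < a i e) (hS : ∀ i ∈ s, ∑ e ∈ E, a i e ≤ S i) :
    ∑ e ∈ E, ∏ i ∈ s, a i e ^ x i ≤ ∏ i ∈ s, S i ^ x i := by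
  set X := ∑ i ∈ s, x i with hX
  have hX0 : 0 < X := by linarith
  have hle : ∀ i ∈ s, ∀ e ∈ E, a i e ≤ S i := fun i hi e he =>
    (Finset.single_le_sum (f := a i) (fun e' he' => (ha i hi e' he').le) he).trans (hS i hi)
  rcases E.eq_empty_or_nonempty with rfl | ⟨e₀, he₀⟩
  · rw [Finset.sum_empty]
    exact Finset.prod_nonneg fun i hi => Real.rpow_nonneg
      (le_trans (by simp) (hS i hi)) _
  have hS0 : ∀ i ∈ s, 0 < S i := fun i hi => (ha i hi e₀ he₀).trans_le (hle i hi e₀ he₀)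
  have hP : 0 < ∏ i ∈ s, S i ^ x i := Finset.prod_pos fun i hi => Real.rpow_pos_of_pos (hS0 i hi) _
  have key : ∀ e ∈ E, ∏ i ∈ s, a i e ^ x i ≤
      (∏ i ∈ s, S i ^ x i) * ∑ i ∈ s, x i / X * (a i e / S i) := by
    intro e he
    have h1 : ∏ i ∈ s, a i e ^ x i = (∏ i ∈ s, S i ^ x i) * ∏ i ∈ s, (a i e / S i) ^ x i := by
      rw [← Finset.prod_mul_distrib]
      refine Finset.prod_congr rfl fun i hi => ?_
      rw [← Real.mul_rpow (hS0 i hi).le (div_pos (ha i hi e he) (hS0 i hi)).le,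
        mul_div_cancel₀ _ (hS0 i hi).ne']
    rw [h1]
    refine mul_le_mul_of_nonneg_left ?_ hP.le
    have h2 : ∏ i ∈ s, (a i e / S i) ^ x i ≤ ∏ i ∈ s, (a i e / S i) ^ (x i / X) := by
      refine Finset.prod_le_prod (fun i hi => ?_) fun i hi => ?_
      · exact Real.rpow_nonneg (div_pos (ha i hi e he) (hS0 i hi)).le _
      · refine Real.rpow_le_rpow_of_exponent_ge (div_pos (ha i hi e he) (hS0 i hi))
          ((div_le_one (hS0 i hi)).2 (hle i hi e he)) (div_le_self (hx i) hs)
    refine h2.trans ?_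
    refine Real.geom_mean_le_arith_mean_weighted s _ _ (fun i _ => div_nonneg (hx i) hX0.le) ?_
      fun i hi => (div_pos (ha i hi e he) (hS0 i hi)).le
    rw [← Finset.sum_div, div_self hX0.ne']
  refine (Finset.sum_le_sum key).trans ?_
  rw [← Finset.mul_sum]
  refine mul_le_of_le_one_right hP.le ?_
  rw [Finset.sum_comm]
  calc ∑ i ∈ s, ∑ e ∈ E, x i / X * (a i e / S i) ≤ ∑ i ∈ s, x i / X := by
        refine Finset.sum_le_sum fun i hi => ?_
        rw [← Finset.mul_sum, ← Finset.sum_div]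
        exact mul_le_of_le_one_right (div_nonneg (hx i) hX0.le)
          ((div_le_one (hS0 i hi)).2 (hS i hi))
    _ = 1 := by rw [← Finset.sum_div, div_self hX0.ne']

/-- The weight of a prefix in the inductive proof of the AGM bound. -/
def prefixWeight (x : Fin n → ℝ) (p : List V) : ℝ := ∏ i, ((matching D i p).card : ℝ) ^ x i

lemma prod_binds_mul (j : ℕ) (f : Fin n → ℝ) :
    ∏ i, f i = (∏ i ∈ Finset.univ.filter (fun i => D.Binds i j), f i) *
      ∏ i ∈ Finset.univ.filter (fun i => ¬ D.Binds i j), f i :=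
  (Finset.prod_filter_mul_prod_filter_not _ _ _).symm

lemma one_le_sum_binds {x : Fin n → ℝ} (hx : D.IsFractionalEdgeCover x) {j : ℕ} (hj : j < m) :
    1 ≤ ∑ i ∈ Finset.univ.filter (fun i => D.Binds i j), x i := by
  rw [Finset.sum_filter]
  convert hx.2 ⟨j, hj⟩ using 3
  simp [Instance.Binds, hj]

lemma sum_prefixWeight_child_le (hD : D.Covered) {x : Fin n → ℝ} (hx : D.IsFractionalEdgeCover x)
    {j : ℕ} (hj : j < m) {p : List V} (hp : p.length = j) :
    ((((unitsAt D j p).filterMap (child D j) : List (List V)) : Multiset (List V)).map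
      (prefixWeight D x)).sum ≤ prefixWeight D x p := by
  obtain ⟨E, hE', hE⟩ := filterMap_child D hD hj hp
  rw [hE, Multiset.map_map]
  change ∑ e ∈ E, prefixWeight D x (p ++ [e]) ≤ _
  unfold prefixWeight
  rw [prod_binds_mul D j, Finset.sum_congr rfl fun e _ => prod_binds_mul D j _]
  have h1 : ∀ e ∈ E, ∏ i ∈ Finset.univ.filter (fun i => ¬ D.Binds i j),
      ((matching D i (p ++ [e])).card : ℝ) ^ x i =
      ∏ i ∈ Finset.univ.filter (fun i => ¬ D.Binds i j), ((matching D i p).card : ℝ) ^ x i := by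
    intro e _
    refine Finset.prod_congr rfl fun i hi => ?_
    rw [matching_snoc_of_not_binds D (by rw [hp]; exact (Finset.mem_filter.1 hi).2)]
  rw [Finset.sum_congr rfl fun e he => by rw [h1 e he], ← Finset.sum_mul]
  refine mul_le_mul_of_nonneg_right ?_
    (Finset.prod_nonneg fun i _ => Real.rpow_nonneg (Nat.cast_nonneg _) _)
  refine sum_prod_rpow_le _ E x hx.1 (one_le_sum_binds D hx hj)
    (fun i e => ((matching D i (p ++ [e])).card : ℝ)) _ ?_ ?_
  · intro i hi e he
    have := (hE' e).1 he i (Finset.mem_filter.1 hi).2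
    rw [inExt_iff] at this
    exact_mod_cast this
  · intro i hi
    exact_mod_cast sum_card_matching_snoc_le D (by rw [hp]; exact (Finset.mem_filter.1 hi).2) E

lemma sum_prefixWeight_reach_le (hD : D.Covered) (hR : ∀ i, (D.rel i).Nonempty) {x : Fin n → ℝ}
    (hx : D.IsFractionalEdgeCover x) {j : ℕ} (hj : j ≤ m) :
    ((reach D j).map (prefixWeight D x)).sum ≤ ∏ i, ((D.rel i).card : ℝ) ^ x i := by
  induction j with
  | zero =>
    simp only [reach, Multiset.map_singleton, Multiset.sum_singleton, prefixWeight]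
    refine Finset.prod_le_prod (fun i _ => Real.rpow_nonneg (Nat.cast_nonneg _) _) fun i _ => ?_
    exact Real.rpow_le_rpow (Nat.cast_nonneg _)
      (by exact_mod_cast Finset.card_le_card (Finset.filter_subset _ _)) (hx.1 i)
  | succ j ih =>
    refine le_trans ?_ (ih (by omega))
    rw [reach, Multiset.map_bind, Multiset.sum_bind]
    refine Multiset.sum_map_le_sum_map _ _ fun p hp => ?_
    exact sum_prefixWeight_child_le D hD hx (by omega) ((reach_spec D hD hR (by omega)).2 p hp).1

lemma length_unitsAt_le (hD : D.Covered) {x : Fin n → ℝ} (hx : D.IsFractionalEdgeCover x)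
    {j : ℕ} (hj : j < m) {p : List V} (h : ∀ i, D.InExt i p) :
    ((unitsAt D j p).length : ℝ) ≤ prefixWeight D x p := by
  obtain ⟨i₀, h1, h2, h3⟩ := unitsAt_eq D hD hj p
  rw [h3, List.length_map, List.length_range]
  have hN : ∀ i, (1 : ℝ) ≤ (matching D i p).card := fun i => by
    have := (inExt_iff D i p).1 (h i)
    exact_mod_cast this
  rcases Nat.eq_zero_or_pos (D.ext i₀ p).card with h0 | h0
  · rw [h0, Nat.cast_zero]
    exact Finset.prod_nonneg fun i _ => Real.rpow_nonneg (Nat.cast_nonneg _) _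
  have h0' : (1 : ℝ) ≤ (D.ext i₀ p).card := by exact_mod_cast h0
  calc ((D.ext i₀ p).card : ℝ)
      ≤ ((D.ext i₀ p).card : ℝ) ^ (∑ i ∈ Finset.univ.filter (fun i => D.Binds i j), x i) := by
        conv_lhs => rw [← Real.rpow_one ((D.ext i₀ p).card : ℝ)]
        exact Real.rpow_le_rpow_of_exponent_le h0' (one_le_sum_binds D hx hj)
    _ = ∏ i ∈ Finset.univ.filter (fun i => D.Binds i j), ((D.ext i₀ p).card : ℝ) ^ x i :=
        Real.rpow_sum_of_pos (by linarith) _ _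
    _ ≤ ∏ i ∈ Finset.univ.filter (fun i => D.Binds i j), ((matching D i p).card : ℝ) ^ x i := by
        refine Finset.prod_le_prod (fun i _ => Real.rpow_nonneg (Nat.cast_nonneg _) _)
          fun i hi => Real.rpow_le_rpow (Nat.cast_nonneg _) ?_ (hx.1 i)
        exact_mod_cast (h2 i (Finset.mem_filter.1 hi).2).trans (card_ext_le D i p)
    _ ≤ prefixWeight D x p := by
        rw [prefixWeight, prod_binds_mul D j]
        refine le_mul_of_one_le_right
          (Finset.prod_nonneg fun i _ => Real.rpow_nonneg (Nat.cast_nonneg _) _) ?_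
        refine one_le_prod_of_one_le _ fun i _ => ?_
        exact Real.one_le_rpow (hN i) (hx.1 i)

/-- The number of candidate extensions of each level is at most the AGM bound. -/
lemma card_unitsAt_reach_le (hD : D.Covered) (hR : ∀ i, (D.rel i).Nonempty) {j : ℕ} (hj : j < m) :
    ((levelUnits D j (reach D j)).card : ℝ) ≤ D.maxOut := by
  have hne : Nonempty {x : Fin n → ℝ // D.IsFractionalEdgeCover x} := by
    refine ⟨⟨fun _ => 1, fun _ => zero_le_one, fun a => ?_⟩⟩
    obtain ⟨i, hi⟩ := hD a
    refine le_trans ?_ (Finset.single_le_sum (fun i' _ => ?_) (Finset.mem_univ i))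
    · simp [hi]
    · split_ifs <;> norm_num
  refine le_ciInf fun x => le_trans ?_ (sum_prefixWeight_reach_le D hD hR x.2 hj.le)
  rw [levelUnits, Multiset.card_bind, Nat.cast_multiset_sum, Multiset.map_map]
  refine Multiset.sum_map_le_sum_map _ _ fun p hp => ?_
  simpa using length_unitsAt_le D hD x.2 hj ((reach_spec D hD hR hj.le).2 p hp).2

lemma one_le_maxOut (hD : D.Covered) (hR : ∀ i, (D.rel i).Nonempty) : 1 ≤ D.maxOut := by
  have hne : Nonempty {x : Fin n → ℝ // D.IsFractionalEdgeCover x} := by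
    refine ⟨⟨fun _ => 1, fun _ => zero_le_one, fun a => ?_⟩⟩
    obtain ⟨i, hi⟩ := hD a
    refine le_trans ?_ (Finset.single_le_sum (fun i' _ => ?_) (Finset.mem_univ i))
    · simp [hi]
    · split_ifs <;> norm_num
  refine le_ciInf fun x => one_le_prod_of_one_le _ fun i _ => ?_
  refine Real.one_le_rpow ?_ (x.2.1 i)
  exact_mod_cast (hR i).card_pos

end Matching

/-! ## Batches -/

section Run

variable {m n : ℕ} {V : Type*} (D : Instance m n V) {w : ℕ} (B' : ℕ)

lemma coe_flatMap_finRange {α : Type*} (f : Fin w → List α) :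
    (Multiset.ofList ((List.finRange w).flatMap f)) = ∑ k, Multiset.ofList (f k) := by
  rw [Fin.sum_univ_def]
  induction List.finRange w with
  | nil => rfl
  | cons k L ih => rw [List.flatMap_cons, ← Multiset.coe_add, ih, List.map_cons, List.sum_cons]

lemma sum_flatMap_finRange {α : Type*} (g : List α → ℕ) (h0 : g [] = 0)
    (hg : ∀ a b, g (a ++ b) = g a + g b) (f : Fin w → List α) :
    g ((List.finRange w).flatMap f) = ∑ k, g (f k) := by
  rw [Fin.sum_univ_def]
  induction List.finRange w with
  | nil => simpa using h0
  | cons k L ih => rw [List.flatMap_cons, hg, ih, List.map_cons, List.sum_cons]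

/-- The pending units of work of level `j`. -/
def pending (S : State n V w) (j : ℕ) : Multiset (List V × Fin n × ℕ) :=
  ∑ k, Multiset.ofList (unitList (S.queue j k))

/-- The units of work of a batch of level `j`. -/
def batchUnits (S : State n V w) (j : ℕ) : Multiset (List V × Fin n × ℕ) :=
  ∑ k, Multiset.ofList (batch B' S j k)

/-- The survivors of a batch of level `j` at each worker. -/
def survivors (S : State n V w) (j : ℕ) (k : Fin w) : List (List V) :=
  (batch B' S j k).filterMap (child D j)

lemma intersect_eq (is : List (Fin n)) (X : Fin w → List (List V)) (k : Fin w) :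
    intersect D is X k = (X k).filter fun c => ∀ i ∈ is, D.InExt i c := by
  induction is generalizing X with
  | nil => simp [intersect]
  | cons i is ih =>
    rw [intersect, ih, List.filter_filter]
    refine List.filter_congr fun c _ => ?_
    simp [Bool.and_comm]

lemma intersect_candidates (S : State n V w) (j : ℕ) :
    intersect D (D.relsAt j) (candidates D B' S j) = survivors D B' S j := by
  funext k
  rw [intersect_eq, candidates, List.filter_filterMap]
  rfl

lemma extend_eq (S : State n V w) (j : ℕ) :
    extend D B' S j = settle D (popBatch B' S j) (j + 1) (survivors D B' S j) := by
  rw [extend, intersect_candidates]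

lemma batch_eq (S : State n V w) (j : ℕ) (k : Fin w) :
    batch B' S j k = (unitList (S.queue j k)).take B' := unitList_takeWork _ _

lemma length_batch (S : State n V w) (j : ℕ) (k : Fin w) :
    (batch B' S j k).length = min B' (total (S.queue j k)) := by
  rw [batch_eq, List.length_take, length_unitList]

lemma length_survivors_le (S : State n V w) (j : ℕ) (k : Fin w) :
    (survivors D B' S j k).length ≤ (batch B' S j k).length := List.length_filterMap_le _ _

lemma sum_survivors (S : State n V w) (j : ℕ) :
    ∑ k, Multiset.ofList (survivors D B' S j k) = (batchUnits B' S j).filterMap (child D j) := by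
  unfold batchUnits
  rw [← coe_flatMap_finRange, ← coe_flatMap_finRange, Multiset.filterMap_coe]
  congr 1
  induction List.finRange w with
  | nil => rfl
  | cons k L ih => rw [List.flatMap_cons, List.flatMap_cons, List.filterMap_append, ← ih]; rfl

lemma popBatch_queue_self (S : State n V w) (j : ℕ) (k : Fin w) :
    (popBatch B' S j).queue j k = dropWork B' (S.queue j k) :=
  congrFun (Function.update_self j _ S.queue) k

lemma popBatch_queue_ne (S : State n V w) {j j' : ℕ} (h : j' ≠ j) :
    (popBatch B' S j).queue j' = S.queue j' := Function.update_of_ne h _ S.queue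

lemma batchUnits_add_pending_popBatch (S : State n V w) (j : ℕ) :
    batchUnits B' S j + pending (popBatch B' S j) j = pending S j := by
  unfold batchUnits pending
  rw [← Finset.sum_add_distrib]
  refine Finset.sum_congr rfl fun k _ => ?_
  rw [batch_eq, popBatch_queue_self, unitList_dropWork, Multiset.coe_add,
    List.take_append_drop]

/-! ## The effect of `settle` -/

lemma settle_queue_ne (S : State n V w) {j j' : ℕ} (P : Fin w → List (List V)) (h : j' ≠ j) :
    (settle D S j P).queue j' = S.queue j' := by
  unfold settle
  split_ifs
  · exact Function.update_of_ne h _ _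
  · rfl

lemma settle_given_ne (S : State n V w) {j j' : ℕ} (P : Fin w → List (List V)) (h : j' ≠ j) :
    (settle D S j P).given j' = S.given j' := by
  unfold settle
  split_ifs
  · exact Function.update_of_ne h _ _
  · rfl

lemma settle_queue_self (S : State n V w) {j : ℕ} (P : Fin w → List (List V)) (h : j < m)
    (k : Fin w) : (settle D S j P).queue j k =
      S.queue j k ++ (List.finRange w).flatMap fun l => sentPieces D S j P l k := by
  unfold settle
  rw [if_pos h]
  exact congrFun (Function.update_self j _ S.queue) k

lemma settle_given_self (S : State n V w) {j : ℕ} (P : Fin w → List (List V)) (h : j < m)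
    (l : Fin w) : (settle D S j P).given j l = S.given j l + total (newPieces D j (P l)) := by
  unfold settle
  rw [if_pos h]
  exact congrFun (Function.update_self j _ S.given) l

lemma settle_queue_of_le (S : State n V w) {j : ℕ} (P : Fin w → List (List V)) (h : m ≤ j) :
    (settle D S j P).queue = S.queue := by
  unfold settle
  rw [if_neg (by omega)]

lemma settle_out_of_lt (S : State n V w) {j : ℕ} (P : Fin w → List (List V)) (h : j < m) :
    (settle D S j P).out = S.out := by
  unfold settle
  rw [if_pos h]

lemma settle_out_of_le (S : State n V w) {j : ℕ} (P : Fin w → List (List V)) (h : m ≤ j) :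
    (settle D S j P).out = S.out ++ (List.finRange w).flatMap P := by
  unfold settle
  rw [if_neg (by omega)]

lemma coe_unitList_flatMap (f : Fin w → List (Piece n V)) :
    Multiset.ofList (unitList ((List.finRange w).flatMap f)) =
      ∑ k, Multiset.ofList (unitList (f k)) := by
  rw [← coe_flatMap_finRange]
  unfold unitList
  rw [List.flatMap_assoc]

lemma sum_unitList_sentPieces (S : State n V w) (j : ℕ) (P : Fin w → List (List V)) (l : Fin w) :
    ∑ k, Multiset.ofList (unitList (sentPieces D S j P l k)) =
      levelUnits D j (Multiset.ofList (P l)) := by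
  have h := unitList_parcel_perm l.pos (S.given j l) (newPieces D j (P l))
  rw [← Multiset.coe_eq_coe, sum_range_map_flatMap Multiset.ofList rfl (fun _ _ => rfl),
    unitList_newPieces] at h
  rw [levelUnits, Multiset.coe_bind, ← h, ← Fin.sum_univ_eq_sum_range
    (fun k => Multiset.ofList (unitList (parcel w (S.given j l) (newPieces D j (P l)) k)))]
  rfl

lemma levelUnits_add (j : ℕ) (A A' : Multiset (List V)) :
    levelUnits D j (A + A') = levelUnits D j A + levelUnits D j A' := Multiset.add_bind _ _ _

lemma levelUnits_sum (j : ℕ) (P : Fin w → List (List V)) :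
    levelUnits D j (∑ l, Multiset.ofList (P l)) =
      ∑ l, levelUnits D j (Multiset.ofList (P l)) :=
  map_sum (⟨⟨levelUnits D j, rfl⟩, levelUnits_add D j⟩ :
    Multiset (List V) →+ Multiset (List V × Fin n × ℕ)) _ _

lemma pending_settle (S : State n V w) {j : ℕ} (P : Fin w → List (List V)) (h : j < m) :
    pending (settle D S j P) j = pending S j + levelUnits D j (∑ l, Multiset.ofList (P l)) := by
  unfold pending
  rw [levelUnits_sum, Finset.sum_congr rfl fun k _ => by
    rw [settle_queue_self D S P h, unitList_append, ← Multiset.coe_add, coe_unitList_flatMap],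
    Finset.sum_add_distrib, Finset.sum_comm]
  congr 1
  exact Finset.sum_congr rfl fun l _ => sum_unitList_sentPieces D S j P l

lemma allPos_sentPieces (S : State n V w) (j : ℕ) (P : Fin w → List (List V)) (l k : Fin w) :
    AllPos (sentPieces D S j P l k) := allPos_parcel _ _ (allPos_newPieces D j (P l)) _

lemma allPos_settle (S : State n V w) (j : ℕ) (P : Fin w → List (List V))
    (hS : ∀ j k, AllPos (S.queue j k)) (j' : ℕ) (k : Fin w) :
    AllPos ((settle D S j P).queue j' k) := by
  by_cases h : j' = j
  · subst h
    by_cases hj : j' < m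
    · rw [settle_queue_self D S P hj]
      refine (hS _ _).append fun t ht => ?_
      obtain ⟨l, -, hl⟩ := List.mem_flatMap.1 ht
      exact allPos_sentPieces D S j' P l k t hl
    · rw [settle_queue_of_le D S P (by omega)]
      exact hS _ _
  · rw [settle_queue_ne D S P h]
    exact hS _ _

lemma sum_length_sentPieces_le (S : State n V w) (j : ℕ) (P : Fin w → List (List V))
    (l : Fin w) : ∑ k, (sentPieces D S j P l k).length ≤ (P l).length + w := by
  refine le_trans ?_ (Nat.add_le_add_right (length_newPieces_le D j (P l)) w)
  refine le_trans (le_of_eq ?_)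
    (sum_length_parcel_le w (S.given j l) (allPos_newPieces D j (P l)))
  rw [← Fin.sum_univ_eq_sum_range
    (fun k => (parcel w (S.given j l) (newPieces D j (P l)) k).length)]
  rfl

lemma sum_length_sentPieces_le_card (S : State n V w) (j : ℕ) (P : Fin w → List (List V))
    (l : Fin w) : ∑ k, (sentPieces D S j P l k).length ≤
      (levelUnits D j (Multiset.ofList (P l))).card := by
  rw [← sum_unitList_sentPieces D S j P l, Multiset.card_sum]
  refine Finset.sum_le_sum fun k _ => ?_
  rw [Multiset.coe_card, length_unitList]
  exact (allPos_sentPieces D S j P l k).length_le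

/-- The number of units of work of level `j` that are stored at each worker, together with those
already taken up (equally many everywhere), is what `Balance` has assigned to it. -/
def Balanced (S : State n V w) (j : ℕ) : Prop :=
  ∃ c, ∀ k : Fin w, total (S.queue j k) + c = ∑ l, share w (S.given j l) k

lemma Balanced.le {S : State n V w} {j : ℕ} (h : Balanced S j) (k k' : Fin w) :
    total (S.queue j k) ≤ total (S.queue j k') + w := by
  obtain ⟨c, hc⟩ := h
  have h1 := hc k
  have h2 := hc k'
  have h3 : ∑ l, share w (S.given j l) k ≤ ∑ l, (share w (S.given j l) k' + 1) :=
    Finset.sum_le_sum fun l _ => share_le_share_add_one _ _ _ k'.2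
  rw [Finset.sum_add_distrib] at h3
  simp at h3
  omega

lemma Balanced.settle {S : State n V w} {j : ℕ} (h : Balanced S j) (P : Fin w → List (List V))
    (hj : j < m) : Balanced (settle D S j P) j := by
  obtain ⟨c, hc⟩ := h
  refine ⟨c, fun k => ?_⟩
  rw [settle_queue_self D S P hj, total_append,
    sum_flatMap_finRange total rfl total_append]
  have h1 : ∀ l, total (sentPieces D S j P l k) = quota w (S.given j l) (newPieces D j (P l)) k :=
    fun l => total_parcel l.pos _ _ k.2
  rw [Finset.sum_congr rfl fun l _ => h1 l, add_right_comm, hc k, ← Finset.sum_add_distrib]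
  refine Finset.sum_congr rfl fun l _ => ?_
  rw [settle_given_self D S P hj, share_add_quota]

lemma length_queue_settle_le (S : State n V w) {j : ℕ} (P : Fin w → List (List V)) (hj : j < m) :
    ∑ k, ((settle D S j P).queue j k).length ≤
      ∑ k, (S.queue j k).length + ∑ l, ((P l).length + w) := by
  rw [Finset.sum_congr rfl fun k _ => by
    rw [settle_queue_self D S P hj, List.length_append,
      sum_flatMap_finRange List.length rfl (by simp)], Finset.sum_add_distrib, Finset.sum_comm]
  exact Nat.add_le_add_left (Finset.sum_le_sum fun l _ => sum_length_sentPieces_le D S j P l) _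

/-! ## The choice of the level -/

variable {B'}

lemma pairwise_lt_filter_range (p : ℕ → Bool) :
    ((List.range m).filter p).Pairwise (· < ·) := List.pairwise_lt_range.filter _

lemma nextLevel_eq_none {S : State n V w} (h : nextLevel m B' S = none) {j : ℕ} (hj : j < m)
    (k : Fin w) : total (S.queue j k) = 0 := by
  unfold nextLevel at h
  rw [Option.or_eq_none_iff, List.head?_eq_none_iff, List.filter_eq_nil_iff] at h
  have := h.2 j (List.mem_range.2 hj)
  simp only [decide_eq_true_eq, not_exists] at this
  have := this k
  omega

/-- A batch of level `j` in which every worker takes up `B'` units of work. -/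
def FullLevel (m B' : ℕ) (S : State n V w) (j : ℕ) : Prop :=
  (∀ k, B' ≤ total (S.queue j k)) ∧ ∀ j' < m, j < j' → ∃ k, total (S.queue j' k) < B'

/-- A batch that finishes the lowest level at which there is work left. -/
def LastLevel (m B' : ℕ) (S : State n V w) (j : ℕ) : Prop :=
  (∀ j' < m, ∃ k, total (S.queue j' k) < B') ∧ (∃ k, 0 < total (S.queue j k)) ∧
    ∀ j' < j, ∀ k, total (S.queue j' k) = 0

lemma nextLevel_eq_some {S : State n V w} {j : ℕ} (h : nextLevel m B' S = some j) :
    j < m ∧ (FullLevel m B' S j ∨ LastLevel m B' S j) := by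
  unfold nextLevel at h
  rw [Option.or_eq_some_iff] at h
  rcases h with h | ⟨h0, h⟩
  · obtain ⟨L, hL⟩ := List.getLast?_eq_some_iff.1 h
    have hj : j ∈ (List.range m).filter fun j => ∀ k, B' ≤ total (S.queue j k) := by
      rw [hL]; simp
    have hp := pairwise_lt_filter_range (m := m) fun j => ∀ k, B' ≤ total (S.queue j k)
    rw [List.mem_filter, List.mem_range, decide_eq_true_eq] at hj
    refine ⟨hj.1, Or.inl ⟨hj.2, fun j' hj' hlt => ?_⟩⟩
    by_contra! hc
    have hm : j' ∈ (List.range m).filter fun j => ∀ k, B' ≤ total (S.queue j k) := by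
      rw [List.mem_filter, List.mem_range, decide_eq_true_eq]
      exact ⟨hj', hc⟩
    rw [hL] at hm hp
    rcases List.mem_append.1 hm with hm | hm
    · have := (List.pairwise_append.1 hp).2.2 j' hm j (by simp)
      omega
    · simp at hm; omega
  · rw [List.getLast?_eq_none_iff, List.filter_eq_nil_iff] at h0
    obtain ⟨L, hL⟩ := List.head?_eq_some_iff.1 h
    have hj : j ∈ (List.range m).filter fun j => ∃ k, 0 < total (S.queue j k) := by
      rw [hL]; simp
    have hp := pairwise_lt_filter_range (m := m) fun j => ∃ k, 0 < total (S.queue j k)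
    rw [List.mem_filter, List.mem_range, decide_eq_true_eq] at hj
    refine ⟨hj.1, Or.inr ⟨fun j' hj' => ?_, hj.2, fun j' hj' k => ?_⟩⟩
    · have := h0 j' (List.mem_range.2 hj')
      simpa using this
    · by_contra hc
      have hm : j' ∈ (List.range m).filter fun j => ∃ k, 0 < total (S.queue j k) := by
        rw [List.mem_filter, List.mem_range, decide_eq_true_eq]
        exact ⟨by omega, k, by omega⟩
      rw [hL] at hm hp
      rcases List.mem_cons.1 hm with rfl | hm
      · omega
      · have := List.rel_of_pairwise_cons hp hm
        omega

lemma exists_pos_total {S : State n V w} {j : ℕ} (hw : 0 < w) (hB : 0 < B')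
    (h : FullLevel m B' S j ∨ LastLevel m B' S j) : ∃ k, 0 < total (S.queue j k) := by
  rcases h with h | h
  · exact ⟨⟨0, hw⟩, lt_of_lt_of_le hB (h.1 _)⟩
  · exact h.2.1

/-! ## Invariants of the computation -/

/-- The last phase of a level: no new work can arrive. -/
def Low (B' : ℕ) (S : State n V w) (j : ℕ) : Prop :=
  (∀ j' < j, ∀ k, total (S.queue j' k) = 0) ∧ ∀ k, total (S.queue j k) < B'

/-- There is no work left up to level `j`. -/
def EmptyUpTo (S : State n V w) (j : ℕ) : Prop := ∀ j' ≤ j, ∀ k, total (S.queue j' k) = 0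

/-- The phase of a level; at most two batches that are not full increase it. -/
def phase (B' : ℕ) (S : State n V w) (j : ℕ) : ℕ :=
  if EmptyUpTo S j then 2 else if Low B' S j then 1 else 0

/-- The prefixes of level `j` that have arrived when the units `dn` have been taken up. -/
def arrived (dn : ℕ → Multiset (List V × Fin n × ℕ)) : ℕ → Multiset (List V)
  | 0 => {[]}
  | j + 1 => (dn j).filterMap (child D j)

variable (B') in
/-- The invariant of the state `S` after the units `dn j` of each level `j` have been taken up. -/
structure Invariant (S : State n V w) (dn : ℕ → Multiset (List V × Fin n × ℕ)) : Prop where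
  pos : ∀ j k, AllPos (S.queue j k)
  units : ∀ j < m, dn j + pending S j = levelUnits D j (arrived D dn j)
  out : Multiset.ofList S.out = arrived D dn m
  bal : ∀ j < m, Balanced S j ∨ Low B' S j
  len : ∀ j < m, ∑ k, (S.queue j k).length ≤ 4 * (w * B')

variable {D}

lemma extend_queue_self (S : State n V w) (j : ℕ) (k : Fin w) :
    (extend D B' S j).queue j k = dropWork B' (S.queue j k) := by
  rw [extend_eq, settle_queue_ne D _ _ (by omega), popBatch_queue_self]

lemma extend_queue_ne (S : State n V w) {j j' : ℕ} (h : j' ≠ j) (h' : j' ≠ j + 1) :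
    (extend D B' S j).queue j' = S.queue j' := by
  rw [extend_eq, settle_queue_ne D _ _ h', popBatch_queue_ne _ _ h]

lemma extend_given_ne (S : State n V w) {j j' : ℕ} (h' : j' ≠ j + 1) :
    (extend D B' S j).given j' = S.given j' := by
  rw [extend_eq, settle_given_ne D _ _ h', popBatch]

lemma EmptyUpTo.extend {S : State n V w} {j j' : ℕ} (hpos : ∃ k, 0 < total (S.queue j k))
    (h : EmptyUpTo S j') : EmptyUpTo (extend D B' S j) j' := by
  obtain ⟨k₀, hk₀⟩ := hpos
  have hlt : j' < j := by
    by_contra hc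
    have := h j (by omega) k₀
    omega
  intro i hi k
  rw [extend_queue_ne S (by omega) (by omega)]
  exact h i hi k

lemma Low.extend {S : State n V w} {j j' : ℕ} (hpos : ∃ k, 0 < total (S.queue j k))
    (h : Low B' S j') : Low B' (extend D B' S j) j' := by
  obtain ⟨k₀, hk₀⟩ := hpos
  have hlt : j' ≤ j := by
    by_contra hc
    have := h.1 j (by omega) k₀
    omega
  refine ⟨fun i hi k => ?_, fun k => ?_⟩
  · rw [extend_queue_ne S (by omega) (by omega)]
    exact h.1 i hi k
  · by_cases hj : j' = j
    · subst hj
      rw [extend_queue_self, total_dropWork]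
      have := h.2 k
      omega
    · rw [extend_queue_ne S hj (by omega)]
      exact h.2 k

lemma phase_le_phase_extend {S : State n V w} {j : ℕ} (hpos : ∃ k, 0 < total (S.queue j k))
    (j' : ℕ) : phase B' S j' ≤ phase B' (extend D B' S j) j' := by
  unfold phase
  by_cases h1 : EmptyUpTo S j'
  · rw [if_pos h1, if_pos (h1.extend hpos)]
  · rw [if_neg h1]
    by_cases h2 : Low B' S j'
    · rw [if_pos h2, if_pos (h2.extend hpos)]
      split_ifs <;> omega
    · rw [if_neg h2]; omega

lemma total_lt_of_balanced {S : State n V w} {j' : ℕ}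
    (h : ∃ k, total (S.queue j' k) < B') (hb : Balanced S j' ∨ Low B' S j') (k : Fin w) :
    total (S.queue j' k) < B' + w := by
  rcases hb with hb | hb
  · obtain ⟨k', hk'⟩ := h
    have := hb.le k k'
    omega
  · have := hb.2 k
    omega

lemma low_extend_of_lastLevel {S : State n V w} {j : ℕ} (hj : j < m) (hwB : w ≤ B')
    (h : LastLevel m B' S j) (hb : Balanced S j ∨ Low B' S j) : Low B' (extend D B' S j) j := by
  refine ⟨fun i hi k => ?_, fun k => ?_⟩
  · rw [extend_queue_ne S (by omega) (by omega)]
    exact h.2.2 i hi k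
  · rw [extend_queue_self, total_dropWork]
    have := total_lt_of_balanced (h.1 j hj) hb k
    have := k.pos
    omega

lemma phase_lt_phase_extend {S : State n V w} {j : ℕ} (hj : j < m) (hwB : w ≤ B')
    (h : LastLevel m B' S j) (hb : Balanced S j ∨ Low B' S j) :
    phase B' S j + 1 ≤ phase B' (extend D B' S j) j := by
  obtain ⟨k₀, hk₀⟩ := h.2.1
  have h1 : ¬ EmptyUpTo S j := fun hc => by
    have := hc j le_rfl k₀
    omega
  unfold phase
  rw [if_neg h1]
  by_cases h2 : Low B' S j
  · rw [if_pos h2, if_pos]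
    intro i hi k
    rcases hi.lt_or_eq with hi | rfl
    · exact (low_extend_of_lastLevel hj hwB h hb).1 i hi k
    · rw [extend_queue_self, total_dropWork]
      have := h2.2 k
      omega
  · rw [if_neg h2, if_pos (low_extend_of_lastLevel hj hwB h hb)]
    split_ifs <;> omega

lemma card_batchUnits (S : State n V w) (j : ℕ) :
    (batchUnits B' S j).card = ∑ k, (batch B' S j k).length := by
  unfold batchUnits
  rw [Multiset.card_sum]
  rfl

/-- Every batch is paid for by units of work or by a change of phase. -/
lemma le_card_batchUnits_add {S : State n V w} {j : ℕ} (hw : 0 < w) (hwB : w ≤ B') (hj : j < m)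
    (h : FullLevel m B' S j ∨ LastLevel m B' S j) (hb : Balanced S j ∨ Low B' S j) :
    w * B' + w * B' * ∑ j' ∈ Finset.range m, phase B' S j' ≤ (batchUnits B' S j).card +
      w * B' * ∑ j' ∈ Finset.range m, phase B' (extend D B' S j) j' := by
  have hpos := exists_pos_total hw (by omega) h
  rcases h with h | h
  · have h1 : (batchUnits B' S j).card = w * B' := by
      rw [card_batchUnits, Finset.sum_congr rfl fun k _ => by
        rw [length_batch, min_eq_left (h.1 k)]]
      simp
    rw [h1]
    exact Nat.add_le_add_left (Nat.mul_le_mul_left _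
      (Finset.sum_le_sum fun j' _ => phase_le_phase_extend hpos j')) _
  · have h1 : ∑ j' ∈ Finset.range m, phase B' S j' <
        ∑ j' ∈ Finset.range m, phase B' (extend D B' S j) j' :=
      Finset.sum_lt_sum (fun j' _ => phase_le_phase_extend hpos j')
        ⟨j, Finset.mem_range.2 hj, phase_lt_phase_extend hj hwB h hb⟩
    have h2 := Nat.mul_le_mul_left (w * B') (Nat.succ_le_of_lt h1)
    rw [Nat.mul_succ] at h2
    omega

/-- The units of work taken up so far after a further batch of level `j`. -/
def addBatch (B' : ℕ) (S : State n V w) (j : ℕ) (dn : ℕ → Multiset (List V × Fin n × ℕ)) :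
    ℕ → Multiset (List V × Fin n × ℕ) :=
  fun j' => dn j' + if j' = j then batchUnits B' S j else 0

lemma pending_congr {S S' : State n V w} {j : ℕ} (h : S.queue j = S'.queue j) :
    pending S j = pending S' j := by unfold pending; rw [h]

lemma arrived_addBatch_succ (S : State n V w) (j : ℕ)
    (dn : ℕ → Multiset (List V × Fin n × ℕ)) :
    arrived D (addBatch B' S j dn) (j + 1) =
      arrived D dn (j + 1) + (batchUnits B' S j).filterMap (child D j) := by
  simp [arrived, addBatch, Multiset.filterMap_add]

lemma arrived_addBatch_ne (S : State n V w) {j j' : ℕ} (h : j' ≠ j + 1)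
    (dn : ℕ → Multiset (List V × Fin n × ℕ)) :
    arrived D (addBatch B' S j dn) j' = arrived D dn j' := by
  cases j' with
  | zero => rfl
  | succ j' => simp [arrived, addBatch, show j' ≠ j by omega]

lemma Invariant.extend {S : State n V w} {dn : ℕ → Multiset (List V × Fin n × ℕ)}
    (hI : Invariant D B' S dn) (hw : 0 < w) (hwB : w * w ≤ B') {j : ℕ} (hj : j < m)
    (h : FullLevel m B' S j ∨ LastLevel m B' S j) :
    Invariant D B' (extend D B' S j) (addBatch B' S j dn) := by
  have hwB' : w ≤ B' := (Nat.le_mul_self w).trans hwB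
  have hpos := exists_pos_total hw (by omega) h
  have hposPop : ∀ i k, AllPos ((popBatch B' S j).queue i k) := by
    intro i k
    by_cases hi : i = j
    · subst hi
      rw [popBatch_queue_self]
      exact (hI.pos i k).dropWork _
    · rw [popBatch_queue_ne _ _ hi]
      exact hI.pos i k
  have hpopne : ∀ {i}, i ≠ j → (popBatch B' S j).queue i = S.queue i := fun hi => by
    rw [popBatch_queue_ne _ _ hi]
  refine ⟨?_, ?_, ?_, ?_, ?_⟩
  · intro i k
    rw [extend_eq]
    exact allPos_settle D _ _ _ hposPop i k
  · intro i hi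
    have hu := hI.units i hi
    by_cases h1 : i = j + 1
    · subst h1
      rw [arrived_addBatch_succ, levelUnits_add, ← hu, extend_eq, pending_settle D _ _ hi,
        sum_survivors, pending_congr (hpopne (by omega))]
      simp [addBatch, add_assoc]
    · rw [arrived_addBatch_ne S h1, ← hu]
      by_cases h2 : i = j
      · subst h2
        rw [extend_eq, pending_congr (settle_queue_ne D _ _ h1),
          ← batchUnits_add_pending_popBatch B' S i]
        simp [addBatch, add_assoc]
      · rw [pending_congr (extend_queue_ne S h2 h1)]
        simp [addBatch, h2]
  · rw [extend_eq]
    by_cases h1 : j + 1 < m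
    · rw [settle_out_of_lt D _ _ h1, arrived_addBatch_ne S (by omega)]
      exact hI.out
    · have h2 : m = j + 1 := by omega
      rw [settle_out_of_le D _ _ (by omega), ← Multiset.coe_add, coe_flatMap_finRange,
        sum_survivors]
      have h3 := arrived_addBatch_succ (D := D) (B' := B') S j dn
      rw [← h2, ← hI.out] at h3
      exact h3.symm
  · intro i hi
    rcases hI.bal i hi with hb | hb
    · by_cases h1 : i = j + 1
      · subst h1
        left
        rw [extend_eq]
        refine Balanced.settle D ?_ _ hi
        obtain ⟨c, hc⟩ := hb
        refine ⟨c, fun k => ?_⟩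
        rw [hpopne (by omega)]
        exact hc k
      · by_cases h2 : i = j
        · subst h2
          rcases h with h | h
          · left
            obtain ⟨c, hc⟩ := hb
            refine ⟨c + B', fun k => ?_⟩
            rw [extend_queue_self, total_dropWork, extend_given_ne S h1, ← hc k]
            have := h.1 k
            omega
          · right
            exact low_extend_of_lastLevel hi hwB' h (Or.inl hb)
        · left
          obtain ⟨c, hc⟩ := hb
          refine ⟨c, fun k => ?_⟩
          rw [extend_queue_ne S h2 h1, extend_given_ne S h1]
          exact hc k
    · exact Or.inr (hb.extend hpos)
  · intro i hi
    have hl := hI.len i hi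
    by_cases h1 : i = j + 1
    · subst h1
      have hlt : ∃ k, total (S.queue (j + 1) k) < B' := by
        rcases h with h | h
        · exact h.2 _ hi (by omega)
        · exact h.1 _ hi
      rw [extend_eq]
      refine (length_queue_settle_le D _ _ hi).trans ?_
      rw [hpopne (by omega)]
      have h3 : ∑ k, (S.queue (j + 1) k).length ≤ ∑ _k : Fin w, (2 * B') := by
        refine Finset.sum_le_sum fun k _ => ?_
        have h4 := (hI.pos (j + 1) k).length_le
        have h5 := total_lt_of_balanced hlt (hI.bal _ hi) k
        omega
      have h6 : ∑ l, ((survivors D B' S j l).length + w) ≤ ∑ _k : Fin w, (2 * B') := by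
        refine Finset.sum_le_sum fun k _ => ?_
        have h4 := length_survivors_le D B' S j k
        have h5 := length_batch B' S j k
        omega
      simp only [Finset.sum_const, Finset.card_univ, Fintype.card_fin, smul_eq_mul] at h3 h6
      nlinarith
    · by_cases h2 : i = j
      · subst h2
        refine le_trans (Finset.sum_le_sum fun k _ => ?_) hl
        rw [extend_queue_self]
        exact length_dropWork_le _ _
      · rw [extend_queue_ne S h2 h1]
        exact hl

lemma sum_start (hw : 0 < w) : ∑ k, Multiset.ofList (start w k : List (List V)) = {[]} := by
  rw [Finset.sum_eq_single ⟨0, hw⟩]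
  · rfl
  · intro k _ hk
    have : k.val ≠ 0 := fun h => hk (Fin.ext h)
    simp [start, this]
  · simp

lemma invariant_start (hm : 0 < m) (hw : 0 < w) (hwB : w * w ≤ B') :
    Invariant D B' (settle D (emptyState n V w) 0 (start w)) (fun _ => 0) := by
  have hwB' : w ≤ B' := (Nat.le_mul_self w).trans hwB
  have hp : ∀ j, pending (emptyState n V w) j = 0 := fun j => by simp [pending, emptyState]
  refine ⟨?_, ?_, ?_, ?_, ?_⟩
  · exact allPos_settle D _ _ _ fun j k t ht => absurd ht (by simp [emptyState])
  · intro j hj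
    cases j with
    | zero => rw [pending_settle D _ _ hj, sum_start hw, hp]; simp [arrived]
    | succ j => rw [pending_congr (settle_queue_ne D _ _ (by omega)), hp]; simp [arrived, levelUnits]
  · rw [settle_out_of_lt D _ _ hm]
    obtain ⟨m', rfl⟩ := Nat.exists_eq_succ_of_ne_zero hm.ne'
    simp [emptyState, arrived]
  · intro j hj
    left
    have h0 : Balanced (emptyState n V w) j := by
      refine ⟨0, fun k => ?_⟩
      have h1 : share w 0 k = 0 := Nat.div_eq_of_lt (by have := k.2; omega)
      simp [emptyState, h1]
    cases j with
    | zero => exact h0.settle D _ hj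
    | succ j =>
      obtain ⟨c, hc⟩ := h0
      refine ⟨c, fun k => ?_⟩
      rw [settle_queue_ne D _ _ (by omega), settle_given_ne D _ _ (by omega)]
      exact hc k
  · intro j hj
    cases j with
    | zero =>
      refine (length_queue_settle_le D _ _ hj).trans ?_
      have h1 : ∑ l, ((start w l : List (List V)).length + w) ≤ ∑ _l : Fin w, (2 * B') := by
        refine Finset.sum_le_sum fun k _ => ?_
        have : (start w k : List (List V)).length ≤ 1 := by unfold start; split_ifs <;> simp
        omega
      simp only [Finset.sum_const, Finset.card_univ, Fintype.card_fin, smul_eq_mul] at h1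
      simp only [emptyState, List.length_nil, Finset.sum_const_zero, zero_add]
      nlinarith
    | succ j => rw [settle_queue_ne D _ _ (by omega)]; simp [emptyState]

variable (D w B') in
/-- The units of work of each level that have been taken up after `t` batches. -/
def takenUp : ℕ → ℕ → Multiset (List V × Fin n × ℕ)
  | 0 => fun _ => 0
  | t + 1 =>
    match nextLevel m B' (stateAfter D w B' t) with
    | none => takenUp t
    | some j => addBatch B' (stateAfter D w B' t) j (takenUp t)

lemma stateAfter_succ_of_some {t j : ℕ} (h : nextLevel m B' (stateAfter D w B' t) = some j) :
    stateAfter D w B' (t + 1) = extend D B' (stateAfter D w B' t) j := by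
  rw [stateAfter, h]

lemma takenUp_succ_of_some {t j : ℕ} (h : nextLevel m B' (stateAfter D w B' t) = some j) :
    takenUp D w B' (t + 1) = addBatch B' (stateAfter D w B' t) j (takenUp D w B' t) := by
  rw [takenUp, h]

lemma invariant_stateAfter (hm : 0 < m) (hw : 0 < w) (hwB : w * w ≤ B') (t : ℕ) :
    Invariant D B' (stateAfter D w B' t) (takenUp D w B' t) := by
  induction t with
  | zero => exact invariant_start hm hw hwB
  | succ t ih =>
    cases h : nextLevel m B' (stateAfter D w B' t) with
    | none => rw [stateAfter, takenUp, h]; exact ih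
    | some j =>
      rw [stateAfter_succ_of_some h, takenUp_succ_of_some h]
      obtain ⟨h1, h2⟩ := nextLevel_eq_some h
      exact ih.extend hw hwB h1 h2

lemma levelUnits_mono (j : ℕ) {A A' : Multiset (List V)} (h : A ≤ A') :
    levelUnits D j A ≤ levelUnits D j A' := by
  obtain ⟨C, rfl⟩ := Multiset.le_iff_exists_add.1 h
  rw [levelUnits_add]
  exact Multiset.le_add_right _ _

lemma filterMap_levelUnits (j : ℕ) (A : Multiset (List V)) :
    (levelUnits D j A).filterMap (child D j) =
      A.bind fun p => ((unitsAt D j p).filterMap (child D j) : List (List V)) := by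
  induction A using Multiset.induction_on with
  | empty => rfl
  | cons p A ih =>
    rw [levelUnits, Multiset.cons_bind, Multiset.cons_bind, Multiset.filterMap_add]
    rw [levelUnits] at ih
    rw [ih]
    rfl

lemma Invariant.arrived_le {S : State n V w} {dn : ℕ → Multiset (List V × Fin n × ℕ)}
    (hI : Invariant D B' S dn) {j : ℕ} (hj : j ≤ m) : arrived D dn j ≤ reach D j := by
  induction j with
  | zero => exact le_rfl
  | succ j ih =>
    rw [arrived, reach, ← filterMap_levelUnits]
    refine Multiset.filterMap_le_filterMap _ ?_
    refine le_trans ?_ (levelUnits_mono j (ih (by omega)))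
    rw [← hI.units j hj]
    exact Multiset.le_add_right _ _

lemma Invariant.arrived_eq {S : State n V w} {dn : ℕ → Multiset (List V × Fin n × ℕ)}
    (hI : Invariant D B' S dn) (h : nextLevel m B' S = none) {j : ℕ} (hj : j ≤ m) :
    arrived D dn j = reach D j := by
  induction j with
  | zero => rfl
  | succ j ih =>
    have h1 : pending S j = 0 := by
      refine Finset.sum_eq_zero fun k _ => ?_
      have h2 := nextLevel_eq_none h hj k
      rw [← length_unitList, List.length_eq_zero_iff] at h2
      rw [h2]
      rfl
    have h3 := hI.units j hj
    rw [h1, add_zero, ih (by omega)] at h3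
    rw [arrived, reach, ← filterMap_levelUnits, h3]

lemma Invariant.card_levelUnits_arrived_le {S : State n V w}
    {dn : ℕ → Multiset (List V × Fin n × ℕ)} (hI : Invariant D B' S dn) (hD : D.Covered)
    (hR : ∀ i, (D.rel i).Nonempty) {j : ℕ} (hj : j < m) :
    ((levelUnits D j (arrived D dn j)).card : ℝ) ≤ D.maxOut := by
  refine le_trans ?_ (card_unitsAt_reach_le D hD hR hj)
  exact_mod_cast Multiset.card_le_card (levelUnits_mono j (hI.arrived_le hj.le))

lemma Invariant.card_le {S : State n V w}
    {dn : ℕ → Multiset (List V × Fin n × ℕ)} (hI : Invariant D B' S dn) (hD : D.Covered)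
    (hR : ∀ i, (D.rel i).Nonempty) {j : ℕ} (hj : j < m) : ((dn j).card : ℝ) ≤ D.maxOut := by
  refine le_trans ?_ (hI.card_levelUnits_arrived_le hD hR hj)
  rw [← hI.units j hj]
  exact_mod_cast Multiset.card_le_card (Multiset.le_add_right _ _)

lemma mul_le_card_takenUp_add (hm : 0 < m) (hw : 0 < w) (hwB : w * w ≤ B') (t : ℕ)
    (ht : ∀ s < t, nextLevel m B' (stateAfter D w B' s) ≠ none) :
    w * B' * t ≤ ∑ j ∈ Finset.range m, (takenUp D w B' t j).card +
      w * B' * ∑ j ∈ Finset.range m, phase B' (stateAfter D w B' t) j := by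
  induction t with
  | zero => simp
  | succ t ih =>
    have ih := ih fun s hs => ht s (by omega)
    obtain ⟨j, h⟩ := Option.ne_none_iff_exists'.1 (ht t (by omega))
    obtain ⟨h1, h2⟩ := nextLevel_eq_some h
    have h3 := le_card_batchUnits_add (D := D) hw ((Nat.le_mul_self w).trans hwB) h1 h2
      ((invariant_stateAfter hm hw hwB t).bal j h1)
    rw [stateAfter_succ_of_some h, takenUp_succ_of_some h]
    have h4 : ∑ i ∈ Finset.range m,
        (addBatch B' (stateAfter D w B' t) j (takenUp D w B' t) i).card =
        ∑ i ∈ Finset.range m, (takenUp D w B' t i).card +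
          (batchUnits B' (stateAfter D w B' t) j).card := by
      simp only [addBatch, Multiset.card_add, Finset.sum_add_distrib]
      congr 1
      rw [Finset.sum_eq_single j (fun i _ hi => by simp [hi])
        (fun hc => absurd (Finset.mem_range.2 h1) hc), if_pos rfl]
    rw [h4, Nat.mul_succ]
    omega

lemma batches_le (hm : 0 < m) (hw : 0 < w) (hwB : w * w ≤ B') (hD : D.Covered)
    (hR : ∀ i, (D.rel i).Nonempty) (t : ℕ)
    (ht : ∀ s < t, nextLevel m B' (stateAfter D w B' s) ≠ none) :
    (t : ℝ) ≤ m * (D.maxOut / (w * B' : ℕ) + 2) := by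
  have h1 := mul_le_card_takenUp_add hm hw hwB t ht
  have h2 : ∑ j ∈ Finset.range m, phase B' (stateAfter D w B' t) j ≤ m * 2 := by
    refine (Finset.sum_le_card_nsmul _ _ 2 fun j _ => ?_).trans (by simp)
    unfold phase; split_ifs <;> omega
  have h3 : (∑ j ∈ Finset.range m, ((takenUp D w B' t j).card : ℝ)) ≤ m * D.maxOut := by
    refine (Finset.sum_le_card_nsmul _ _ D.maxOut fun j hj => ?_).trans (by simp)
    exact (invariant_stateAfter hm hw hwB t).card_le hD hR (Finset.mem_range.1 hj)
  have hB : 0 < w * B' := by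
    have : 0 < w * w := Nat.mul_pos hw hw
    exact Nat.mul_pos hw (by omega)
  have hB' : (0 : ℝ) < (w * B' : ℕ) := by exact_mod_cast hB
  have h4 : ((w * B' : ℕ) : ℝ) * t ≤ m * D.maxOut + (w * B' : ℕ) * (m * 2) := by
    refine le_trans ?_ (add_le_add_left h3 _)
    have h5 := h1.trans (Nat.add_le_add_left (Nat.mul_le_mul_left (w * B') h2) _)
    exact_mod_cast h5
  refine le_of_mul_le_mul_left (h4.trans (le_of_eq ?_)) hB'
  field_simp

lemma exists_nextLevel_eq_none (hm : 0 < m) (hw : 0 < w) (hwB : w * w ≤ B') (hD : D.Covered)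
    (hR : ∀ i, (D.rel i).Nonempty) : ∃ t, nextLevel m B' (stateAfter D w B' t) = none := by
  by_contra! hc
  obtain ⟨t, ht⟩ := exists_nat_gt ((m : ℝ) * (D.maxOut / (w * B' : ℕ) + 2))
  exact absurd (batches_le hm hw hwB hD hR t fun s _ => hc s) (not_le.2 ht)

lemma numBatches_le (hm : 0 < m) (hw : 0 < w) (hwB : w * w ≤ B') (hD : D.Covered)
    (hR : ∀ i, (D.rel i).Nonempty) :
    (numBatches D w B' : ℝ) ≤ m * (D.maxOut / (w * B' : ℕ) + 2) :=
  batches_le hm hw hwB hD hR _ fun _ hs => Nat.notMem_of_lt_sInf hs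

/-- The output consists of the results of the query. -/
lemma mem_out_iff (hm : 0 < m) (hw : 0 < w) (hwB : w * w ≤ B') (hD : D.Covered)
    (hR : ∀ i, (D.rel i).Nonempty) (p : List V) :
    p ∈ (stateAfter D w B' (numBatches D w B')).out ↔
      ∃ x : Fin m → V, D.IsResult x ∧ p = List.ofFn x := by
  have h1 : nextLevel m B' (stateAfter D w B' (numBatches D w B')) = none :=
    Nat.sInf_mem (exists_nextLevel_eq_none hm hw hwB hD hR)
  have hI := invariant_stateAfter (D := D) hm hw hwB (numBatches D w B')
  rw [← mem_reach_iff D hD hR, ← hI.arrived_eq h1 le_rfl, ← hI.out, Multiset.mem_coe]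

end Run

/-! ## The schedule of an execution

The look-ups and exchanges of an execution do not depend on the distribution of the index. -/

/-- A step of an execution: a look-up, or a round that does not involve the index. -/
inductive Step (n : ℕ) (V : Type*) (w : ℕ)
  | lookup (stored : Fin w → ℕ) (keys : Fin w → List (Key n V))
  | exchange (r : Round w)

namespace Step

variable {n : ℕ} {V : Type*} {w : ℕ}

/-- The rounds of a step. -/
def rounds (h : Key n V → Fin w) : Step n V w → List (Round w)
  | lookup stored keys => lookupRounds h stored keys
  | exchange r => [r]

/-- A bound on the computation of a step. -/
def cost : Step n V w → ℕ
  | lookup _ keys => 3 * ∑ k, (keys k).length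
  | exchange r => ∑ k, r.comp k

/-- The worker-wise and memory bounds that hold for every step, whatever the distribution of the
index. -/
def Bounded (m B' : ℕ) : Step n V w → Prop
  | lookup stored keys => (∀ k, (keys k).length ≤ B') ∧ ∑ k, stored k ≤ 4 * (m * (w * B'))
  | exchange r => (∀ k, r.sent k ≤ 2 * B') ∧ (∀ k, r.received k ≤ 6 * B') ∧
      (∀ k, r.comp k ≤ 9 * B') ∧ ∑ k, (r.held k + r.received k) ≤ 7 * (m * (w * B')) ∧
      ∑ k, r.received k ≤ ∑ k, r.comp k

end Step

section Schedule

variable {m n : ℕ} {V : Type*} (D : Instance m n V) {w : ℕ} (B' : ℕ)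

def intersectSteps (stored : Fin w → ℕ) (j : ℕ) :
    List (Fin n) → (Fin w → List (List V)) → List (Step n V w)
  | [], _ => []
  | i :: is, X =>
    .lookup stored (fun k => (X k).map fun c => Key.mem i j (D.proj i c)) ::
      intersectSteps stored j is fun k => (X k).filter (fun c => D.InExt i c)

def countSteps (stored : Fin w → ℕ) (j : ℕ) (P : Fin w → List (List V)) : List (Step n V w) :=
  (D.relsAt j).map fun i => .lookup stored fun k => (P k).map fun p => Key.count i j (D.proj i p)

def settleSteps (S : State n V w) (j : ℕ) (P : Fin w → List (List V)) : List (Step n V w) :=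
  if j < m then countSteps D (S.stored m) j P ++ [.exchange (balanceRound D S j P)] else []

def extendSteps (S : State n V w) (j : ℕ) : List (Step n V w) :=
  .lookup ((popBatch B' S j).stored m) (fun k => (batch B' S j k).map (resolveKey D j)) ::
    (intersectSteps D ((popBatch B' S j).stored m) j (D.relsAt j) (candidates D B' S j) ++
      settleSteps D (popBatch B' S j) (j + 1) (survivors D B' S j))

/-- The steps of batch number `t`. -/
def batchSteps (w t : ℕ) : List (Step n V w) :=
  match nextLevel m B' (stateAfter D w B' t) with
  | none => []
  | some j => extendSteps D B' (stateAfter D w B' t) j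

/-- The steps up to batch number `t`. -/
def scheduleUpTo (w t : ℕ) : List (Step n V w) :=
  settleSteps D (emptyState n V w) 0 (start w) ++ (List.range t).flatMap (batchSteps D B' w)

variable {D B'}

lemma intersectRounds_eq (h : Key n V → Fin w) (stored : Fin w → ℕ) (j : ℕ) (is : List (Fin n))
    (X : Fin w → List (List V)) : intersectRounds D h stored j is X =
      (intersectSteps D stored j is X).flatMap (Step.rounds h) := by
  induction is generalizing X with
  | nil => rfl
  | cons i is ih => rw [intersectRounds, intersectSteps, List.flatMap_cons, ih]; rfl

lemma settleRounds_eq (h : Key n V → Fin w) (S : State n V w) (j : ℕ)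
    (P : Fin w → List (List V)) :
    settleRounds D h S j P = (settleSteps D S j P).flatMap (Step.rounds h) := by
  unfold settleRounds settleSteps
  split_ifs
  · rw [List.flatMap_append, countSteps, List.flatMap_map]
    rfl
  · rfl

lemma extendRounds_eq (h : Key n V → Fin w) (S : State n V w) (j : ℕ) :
    extendRounds D B' h S j = (extendSteps D B' S j).flatMap (Step.rounds h) := by
  rw [extendRounds, extendSteps, List.flatMap_cons, List.flatMap_append, ← intersectRounds_eq,
    ← settleRounds_eq, intersect_candidates, List.append_assoc]
  rfl

lemma rounds_eq (h : Key n V → Fin w) : rounds D B' h =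
    (scheduleUpTo D B' w (numBatches D w B')).flatMap (Step.rounds h) := by
  rw [rounds, scheduleUpTo, List.flatMap_append, settleRounds_eq, List.flatMap_assoc]
  congr 1
  refine List.flatMap_congr fun t _ => ?_
  unfold batchSteps
  cases nextLevel m B' (stateAfter D w B' t) with
  | none => rfl
  | some j => exact extendRounds_eq h _ _

/-! ### Lengths -/

lemma length_intersectSteps (stored : Fin w → ℕ) (j : ℕ) (is : List (Fin n))
    (X : Fin w → List (List V)) : (intersectSteps D stored j is X).length = is.length := by
  induction is generalizing X with
  | nil => rfl
  | cons i is ih => rw [intersectSteps, List.length_cons, ih, List.length_cons]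

lemma length_settleSteps_le (S : State n V w) (j : ℕ) (P : Fin w → List (List V)) :
    (settleSteps D S j P).length ≤ n + 1 := by
  unfold settleSteps
  split_ifs
  · have := length_relsAt_le D j
    simp [countSteps, this]
  · simp

lemma length_batchSteps_le (t : ℕ) : (batchSteps D B' w t).length ≤ 2 * (n + 1) := by
  unfold batchSteps
  cases nextLevel m B' (stateAfter D w B' t) with
  | none => simp
  | some j =>
    have h1 := length_relsAt_le D j
    have h2 := length_settleSteps_le (D := D) (popBatch B' (stateAfter D w B' t) j) (j + 1)
      (survivors D B' (stateAfter D w B' t) j)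
    simp only [extendSteps, List.length_cons, List.length_append, length_intersectSteps]
    omega

lemma length_scheduleUpTo_le (t : ℕ) :
    (scheduleUpTo D B' w t).length ≤ (n + 1) * (1 + 2 * t) := by
  have h1 : ((List.range t).flatMap (batchSteps D B' w)).length ≤ t * (2 * (n + 1)) := by
    rw [sum_range_map_flatMap List.length rfl (by simp)]
    exact (Finset.sum_le_card_nsmul _ _ _ fun s _ => length_batchSteps_le s).trans (by simp)
  have h2 := length_settleSteps_le (D := D) (emptyState n V w) 0 (start w)
  rw [scheduleUpTo, List.length_append]
  nlinarith

lemma length_flatMap_rounds_le (h : Key n V → Fin w) (L : List (Step n V w)) :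
    (L.flatMap (Step.rounds h)).length ≤ 2 * L.length := by
  induction L with
  | nil => simp
  | cons s L ih =>
    rw [List.flatMap_cons, List.length_append, List.length_cons]
    have : (s.rounds h).length ≤ 2 := by
      cases s <;> simp [Step.rounds, lookupRounds]
    omega

/-! ### Messages -/

lemma countP_flatMap_finRange {α : Type*} (p : α → Bool) (f : Fin w → List α) :
    ((List.finRange w).flatMap f).countP p = ∑ k, (f k).countP p :=
  sum_flatMap_finRange (fun L => L.countP p) rfl (fun _ _ => List.countP_append) f

lemma countP_map_const {α β : Type*} (p : β → Bool) (b : β) (L : List α) :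
    (L.map fun _ => b).countP p = if p b then L.length else 0 := by
  rw [List.countP_map]
  split_ifs with h
  · rw [List.countP_eq_length]
    exact fun _ _ => h
  · rw [List.countP_eq_zero]
    exact fun _ _ => h

lemma sum_received (r : Round w) : ∑ k, r.received k = r.msgs.length := by
  unfold Round.received
  induction r.msgs with
  | nil => simp
  | cons e L ih => simp [List.countP_cons, Finset.sum_add_distrib, ih]

lemma sent_balanceRound (S : State n V w) (j : ℕ) (P : Fin w → List (List V)) (k : Fin w) :
    (balanceRound D S j P).sent k = ∑ k', (sentPieces D S j P k k').length := by
  unfold Round.sent balanceRound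
  simp only [countP_flatMap_finRange, countP_map_const, decide_eq_true_eq]
  rw [Finset.sum_eq_single k]
  · simp
  · intro l _ hl
    simp [hl]
  · simp

lemma received_balanceRound (S : State n V w) (j : ℕ) (P : Fin w → List (List V)) (k : Fin w) :
    (balanceRound D S j P).received k = ∑ l, (sentPieces D S j P l k).length := by
  unfold Round.received balanceRound
  simp only [countP_flatMap_finRange, countP_map_const, decide_eq_true_eq]
  refine Finset.sum_congr rfl fun l _ => ?_
  rw [Finset.sum_eq_single k]
  · simp
  · intro l _ hl
    simp [hl]
  · simp

/-- The number of requests that a worker gets in a look-up. -/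
def requests (h : Key n V → Fin w) (keys : Fin w → List (Key n V)) (k : Fin w) : ℕ :=
  ∑ l, (keys l).dedup.countP fun κ => h κ = k

/-- The request messages of a look-up. -/
def requestMsgs (h : Key n V → Fin w) (keys : Fin w → List (Key n V)) : List (Fin w × Fin w) :=
  (List.finRange w).flatMap fun k => (keys k).dedup.map fun κ => (k, h κ)

lemma lookupRounds_eq (h : Key n V → Fin w) (stored : Fin w → ℕ)
    (keys : Fin w → List (Key n V)) : lookupRounds h stored keys =
      [{ msgs := requestMsgs h keys
         comp := fun k => (keys k).length
         held := fun k => stored k + (keys k).length },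
       { msgs := (requestMsgs h keys).map Prod.swap
         comp := fun k => (requestMsgs h keys).countP (fun e => e.2 = k) + (keys k).length
         held := fun k => stored k + (keys k).length }] := rfl

lemma countP_snd_requestMsgs (h : Key n V → Fin w) (keys : Fin w → List (Key n V)) (k : Fin w) :
    (requestMsgs h keys).countP (fun e => e.2 = k) = requests h keys k := by
  unfold requestMsgs requests
  rw [countP_flatMap_finRange]
  refine Finset.sum_congr rfl fun l _ => ?_
  rw [List.countP_map]
  rfl

lemma countP_fst_requestMsgs_le (h : Key n V → Fin w) (keys : Fin w → List (Key n V))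
    (k : Fin w) : (requestMsgs h keys).countP (fun e => e.1 = k) ≤ (keys k).length := by
  unfold requestMsgs
  rw [countP_flatMap_finRange, Finset.sum_eq_single k]
  · refine List.countP_le_length.trans ?_
    rw [List.length_map]
    exact (List.dedup_sublist _).length_le
  · intro l _ hl
    rw [List.countP_map, List.countP_eq_zero]
    intro κ _
    simp [hl]
  · simp

lemma length_requestMsgs_le (h : Key n V → Fin w) (keys : Fin w → List (Key n V)) :
    (requestMsgs h keys).length ≤ ∑ k, (keys k).length := by
  unfold requestMsgs
  rw [sum_flatMap_finRange List.length rfl (by simp)]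
  refine Finset.sum_le_sum fun k _ => ?_
  rw [List.length_map]
  exact (List.dedup_sublist _).length_le

lemma sum_requests (h : Key n V → Fin w) (keys : Fin w → List (Key n V)) :
    ∑ k, (requestMsgs h keys).countP (fun e => e.2 = k) = (requestMsgs h keys).length :=
  sum_received ⟨requestMsgs h keys, fun _ => 0, fun _ => 0⟩

/-! ### Bounds on every step -/

lemma sum_stored_le {S : State n V w} (h : ∀ j < m, ∑ k, (S.queue j k).length ≤ 4 * (w * B')) :
    ∑ k, S.stored m k ≤ 4 * (m * (w * B')) := by
  unfold State.stored
  rw [Finset.sum_comm]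
  refine (Finset.sum_le_card_nsmul _ _ _ fun j hj => h j (Finset.mem_range.1 hj)).trans ?_
  simp only [Finset.card_range, smul_eq_mul]
  exact le_of_eq (by ring)

lemma bounded_intersectSteps {stored : Fin w → ℕ} (hs : ∑ k, stored k ≤ 4 * (m * (w * B')))
    (j : ℕ) (is : List (Fin n)) {X : Fin w → List (List V)} (hX : ∀ k, (X k).length ≤ B') :
    ∀ s ∈ intersectSteps D stored j is X, s.Bounded m B' := by
  induction is generalizing X with
  | nil => simp [intersectSteps]
  | cons i is ih =>
    rw [intersectSteps]
    intro s hs'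
    rcases List.mem_cons.1 hs' with rfl | hs'
    · exact ⟨fun k => by simpa using hX k, hs⟩
    · exact ih (fun k => (List.length_filter_le _ _).trans (hX k)) s hs'

lemma sum_length_sentPieces_target_le (hwB : w * w ≤ B') (S : State n V w) (j : ℕ)
    {P : Fin w → List (List V)} (hP : ∀ k, (P k).length ≤ B') (k : Fin w) :
    ∑ l, (sentPieces D S j P l k).length ≤ 6 * B' := by
  have hw := k.pos
  have h1 : w * ∑ l, (sentPieces D S j P l k).length ≤ w * (2 * B' + w * w + 3 * w) := by
    rw [Finset.mul_sum]
    refine (Finset.sum_le_card_nsmul _ _ (2 * B' + w * w + 3 * w) fun l _ => ?_).trans (by simp)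
    refine (length_parcel_mul_le hw _ (allPos_newPieces D j (P l)) _).trans ?_
    have := (length_newPieces_le D j (P l)).trans (hP l)
    omega
  have h2 := Nat.le_of_mul_le_mul_left h1 hw
  have h3 := Nat.le_mul_self w
  omega

lemma bounded_settleSteps (hm : 0 < m) (hwB : w * w ≤ B') {S : State n V w}
    (hS : ∀ j < m, ∑ k, (S.queue j k).length ≤ 4 * (w * B')) (j : ℕ)
    {P : Fin w → List (List V)} (hP : ∀ k, (P k).length ≤ B') :
    ∀ s ∈ settleSteps D S j P, s.Bounded m B' := by
  have hst := sum_stored_le hS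
  have hw3 := Nat.le_mul_self w
  have hsent : ∀ l, ∑ k, (sentPieces D S j P l k).length ≤ 2 * B' := fun l => by
    have h1 := sum_length_sentPieces_le D S j P l
    have h2 := hP l
    omega
  have htgt := sum_length_sentPieces_target_le (D := D) hwB S j hP
  intro s hs
  unfold settleSteps at hs
  split_ifs at hs with hj
  · rcases List.mem_append.1 hs with hs | hs
    · obtain ⟨i, -, rfl⟩ := List.mem_map.1 hs
      exact ⟨fun k => by simpa using hP k, hst⟩
    · obtain rfl := List.mem_singleton.1 hs
      refine ⟨fun k => ?_, fun k => ?_, fun k => ?_, ?_, ?_⟩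
      · rw [sent_balanceRound]
        exact hsent k
      · rw [received_balanceRound]
        exact htgt k
      · have h1 := hP k
        have h2 := hsent k
        have h3 := htgt k
        change (P k).length + _ + _ ≤ _
        omega
      · rw [Finset.sum_add_distrib, Finset.sum_congr rfl fun k _ => received_balanceRound S j P k,
          Finset.sum_comm]
        have h1 : ∑ l, ∑ k, (sentPieces D S j P l k).length ≤ ∑ _l : Fin w, 2 * B' :=
          Finset.sum_le_sum fun l _ => hsent l
        have h2 : ∑ k, (balanceRound D S j P).held k ≤ ∑ k, S.stored m k + ∑ _k : Fin w, B' := by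
          rw [← Finset.sum_add_distrib]
          exact Finset.sum_le_sum fun k _ => Nat.add_le_add_left (hP k) _
        simp only [Finset.sum_const, Finset.card_univ, Fintype.card_fin, smul_eq_mul] at h1 h2
        have h3 : w * B' ≤ m * (w * B') := Nat.le_mul_of_pos_left _ hm
        nlinarith
      · rw [Finset.sum_congr rfl fun k _ => received_balanceRound S j P k]
        exact Finset.sum_le_sum fun k _ => Nat.le_add_left _ _
  · simp at hs

lemma bounded_extendSteps (hm : 0 < m) (hwB : w * w ≤ B') {S : State n V w}
    (hS : ∀ j < m, ∑ k, (S.queue j k).length ≤ 4 * (w * B')) (j : ℕ) :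
    ∀ s ∈ extendSteps D B' S j, s.Bounded m B' := by
  have hpop : ∀ i < m, ∑ k, ((popBatch B' S j).queue i k).length ≤ 4 * (w * B') := by
    intro i hi
    refine le_trans (Finset.sum_le_sum fun k _ => ?_) (hS i hi)
    by_cases h : i = j
    · subst h
      rw [popBatch_queue_self]
      exact length_dropWork_le _ _
    · rw [popBatch_queue_ne _ _ h]
  have hb : ∀ k, (batch B' S j k).length ≤ B' := fun k => by
    rw [length_batch]
    exact min_le_left _ _
  intro s hs
  rw [extendSteps] at hs
  rcases List.mem_cons.1 hs with rfl | hs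
  · exact ⟨fun k => by simpa using hb k, sum_stored_le hpop⟩
  · rcases List.mem_append.1 hs with hs | hs
    · exact bounded_intersectSteps (sum_stored_le hpop) _ _
        (fun k => (List.length_filterMap_le _ _).trans (hb k)) s hs
    · exact bounded_settleSteps hm hwB hpop _
        (fun k => (length_survivors_le D B' S j k).trans (hb k)) s hs

lemma bounded_scheduleUpTo (hm : 0 < m) (hw : 0 < w) (hwB : w * w ≤ B') (t : ℕ) :
    ∀ s ∈ scheduleUpTo D B' w t, s.Bounded m B' := by
  intro s hs
  rcases List.mem_append.1 hs with hs | hs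
  · refine bounded_settleSteps hm hwB ?_ 0 (fun k => ?_) s hs
    · simp [emptyState]
    · have h1 : 0 < w * w := Nat.mul_pos hw hw
      have : (start w k : List (List V)).length ≤ 1 := by unfold start; split_ifs <;> simp
      omega
  · obtain ⟨t', -, hs⟩ := List.mem_flatMap.1 hs
    unfold batchSteps at hs
    cases h : nextLevel m B' (stateAfter D w B' t') with
    | none => simp [h] at hs
    | some j =>
      rw [h] at hs
      exact bounded_extendSteps hm hwB (invariant_stateAfter hm hw hwB t').len j s hs

/-! ### Cumulative costs -/

lemma sum_comp_rounds_le (h : Key n V → Fin w) (s : Step n V w) :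
    ((s.rounds h).map fun r => ∑ k, r.comp k).sum ≤ s.cost := by
  cases s with
  | lookup stored keys =>
    have h1 := length_requestMsgs_le h keys
    simp only [Step.rounds, lookupRounds_eq, List.map_cons, List.map_nil, List.sum_cons,
      List.sum_nil, Finset.sum_add_distrib, sum_requests, Step.cost]
    omega
  | exchange r => simp [Step.rounds, Step.cost]

lemma sum_received_le_sum_comp (h : Key n V → Fin w) {s : Step n V w} (hs : s.Bounded m B')
    {r : Round w} (hr : r ∈ s.rounds h) : ∑ k, r.received k ≤ ∑ k, r.comp k := by
  cases s with
  | lookup stored keys =>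
    have h1 := length_requestMsgs_le h keys
    rw [Step.rounds, lookupRounds_eq, List.mem_pair] at hr
    rcases hr with rfl | rfl
    · rw [sum_received]
      exact h1
    · rw [sum_received, List.length_map]
      refine h1.trans (Finset.sum_le_sum fun k _ => Nat.le_add_left _ _)
  | exchange r' =>
    obtain rfl := List.mem_singleton.1 hr
    exact hs.2.2.2.2

lemma sum_map_flatMap_le {α β : Type*} (f : α → List β) (g : β → ℕ) (c : α → ℕ) (L : List α)
    (h : ∀ a ∈ L, ((f a).map g).sum ≤ c a) :
    ((L.flatMap f).map g).sum ≤ (L.map c).sum := by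
  induction L with
  | nil => simp
  | cons a L ih =>
    rw [List.flatMap_cons, List.map_append, List.sum_append, List.map_cons, List.sum_cons]
    exact Nat.add_le_add (h a (by simp)) (ih fun b hb => h b (by simp [hb]))

/-- The cost of a list of steps. -/
def totalCost (L : List (Step n V w)) : ℕ := (L.map Step.cost).sum

lemma totalCost_append (L L' : List (Step n V w)) :
    totalCost (L ++ L') = totalCost L + totalCost L' := by simp [totalCost]

lemma totalCost_intersectSteps_le (stored : Fin w → ℕ) (j : ℕ) (is : List (Fin n))
    (X : Fin w → List (List V)) :
    totalCost (intersectSteps D stored j is X) ≤ is.length * (3 * ∑ k, (X k).length) := by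
  induction is generalizing X with
  | nil => simp [intersectSteps, totalCost]
  | cons i is ih =>
    have h1 := ih fun k => (X k).filter (fun c => D.InExt i c)
    have h2 : ∑ k, ((X k).filter (fun c => D.InExt i c)).length ≤ ∑ k, (X k).length :=
      Finset.sum_le_sum fun k _ => List.length_filter_le _ _
    have h3 := h1.trans (Nat.mul_le_mul_left _ (Nat.mul_le_mul_left 3 h2))
    rw [intersectSteps, totalCost, List.map_cons, List.sum_cons, ← totalCost, List.length_cons,
      Nat.add_mul, one_mul]
    simp only [Step.cost, List.length_map]
    omega

lemma totalCost_settleSteps_le (S : State n V w) (j : ℕ) (P : Fin w → List (List V)) :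
    totalCost (settleSteps D S j P) ≤ (3 * n + 1) * ∑ k, (P k).length +
      if j < m then 2 * (levelUnits D j (∑ l, Multiset.ofList (P l))).card else 0 := by
  unfold settleSteps
  split_ifs with hj
  · rw [totalCost_append]
    have h1 : totalCost (countSteps D (S.stored m) j P) = (D.relsAt j).length *
        (3 * ∑ k, (P k).length) := by
      unfold totalCost countSteps
      rw [List.map_map]
      simp [Function.comp_def, Step.cost]
    have h2 := Nat.mul_le_mul_right (3 * ∑ k, (P k).length) (length_relsAt_le D j)
    have h3 : ∑ l, ∑ k, (sentPieces D S j P l k).length ≤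
        (levelUnits D j (∑ l, Multiset.ofList (P l))).card := by
      rw [levelUnits_sum, Multiset.card_sum]
      exact Finset.sum_le_sum fun l _ => sum_length_sentPieces_le_card D S j P l
    have h4 : totalCost [Step.exchange (n := n) (V := V) (balanceRound D S j P)] =
        ∑ k, (P k).length + ∑ l, ∑ k, (sentPieces D S j P l k).length +
          ∑ l, ∑ k, (sentPieces D S j P l k).length := by
      unfold totalCost
      simp only [List.map_cons, List.map_nil, List.sum_cons, List.sum_nil, add_zero, Step.cost,
        balanceRound, Finset.sum_add_distrib]
      congr 1
      exact Finset.sum_comm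
    rw [h1, h4]
    nlinarith
  · simp [totalCost]

lemma totalCost_extendSteps_le (S : State n V w) (j : ℕ) :
    totalCost (extendSteps D B' S j) ≤ (6 * n + 4) * (batchUnits B' S j).card +
      if j + 1 < m then
        2 * (levelUnits D (j + 1) ((batchUnits B' S j).filterMap (child D j))).card else 0 := by
  have h1 := totalCost_intersectSteps_le (D := D) ((popBatch B' S j).stored m) j (D.relsAt j)
    (candidates D B' S j)
  have h2 := totalCost_settleSteps_le (D := D) (popBatch B' S j) (j + 1) (survivors D B' S j)
  have h3 : ∑ k, (candidates D B' S j k).length ≤ (batchUnits B' S j).card := by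
    rw [card_batchUnits]
    exact Finset.sum_le_sum fun k _ => List.length_filterMap_le _ _
  have h4 : ∑ k, (survivors D B' S j k).length ≤ (batchUnits B' S j).card := by
    rw [card_batchUnits]
    exact Finset.sum_le_sum fun k _ => length_survivors_le D B' S j k
  have h5 := h1.trans (Nat.mul_le_mul (length_relsAt_le D j) (Nat.mul_le_mul_left 3 h3))
  have h6 := h2.trans (Nat.add_le_add_right (Nat.mul_le_mul_left (3 * n + 1) h4) _)
  rw [sum_survivors] at h6
  rw [extendSteps, totalCost, List.map_cons, List.sum_cons, ← totalCost, totalCost_append]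
  simp only [Step.cost, List.length_map]
  rw [← card_batchUnits]
  linarith

/-- The potential that bounds the cumulative cost. -/
def potential (D : Instance m n V) (dn : ℕ → Multiset (List V × Fin n × ℕ)) : ℕ :=
  (6 * n + 4) * ∑ j ∈ Finset.range m, (dn j).card +
    2 * ∑ j ∈ Finset.range m, (levelUnits D j (arrived D dn j)).card

lemma potential_addBatch (S : State n V w) {j : ℕ} (hj : j < m)
    (dn : ℕ → Multiset (List V × Fin n × ℕ)) :
    potential D (addBatch B' S j dn) = potential D dn +
      ((6 * n + 4) * (batchUnits B' S j).card + if j + 1 < m then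
        2 * (levelUnits D (j + 1) ((batchUnits B' S j).filterMap (child D j))).card else 0) := by
  have h1 : ∑ i ∈ Finset.range m, (addBatch B' S j dn i).card =
      ∑ i ∈ Finset.range m, (dn i).card + (batchUnits B' S j).card := by
    simp only [addBatch, Multiset.card_add, Finset.sum_add_distrib]
    congr 1
    rw [Finset.sum_eq_single j (fun i _ hi => by simp [hi])
      (fun hc => absurd (Finset.mem_range.2 hj) hc), if_pos rfl]
  have h2 : ∑ i ∈ Finset.range m, (levelUnits D i (arrived D (addBatch B' S j dn) i)).card =
      ∑ i ∈ Finset.range m, (levelUnits D i (arrived D dn i)).card + if j + 1 < m then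
        (levelUnits D (j + 1) ((batchUnits B' S j).filterMap (child D j))).card else 0 := by
    have h3 : ∀ i, (levelUnits D i (arrived D (addBatch B' S j dn) i)).card =
        (levelUnits D i (arrived D dn i)).card + if i = j + 1 then
          (levelUnits D (j + 1) ((batchUnits B' S j).filterMap (child D j))).card else 0 := by
      intro i
      split_ifs with hi
      · subst hi
        rw [arrived_addBatch_succ, levelUnits_add, Multiset.card_add]
      · rw [arrived_addBatch_ne S hi, add_zero]
    simp only [h3, Finset.sum_add_distrib, Finset.sum_ite_eq', Finset.mem_range]
  unfold potential
  rw [h1, h2]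
  split_ifs <;> ring

lemma totalCost_scheduleUpTo_le (hm : 0 < m) (hw : 0 < w) (t : ℕ) :
    totalCost (scheduleUpTo D B' w t) ≤ potential D (takenUp D w B' t) + (3 * n + 1) := by
  induction t with
  | zero =>
    have h1 := totalCost_settleSteps_le (D := D) (emptyState n V w) 0 (start w)
    have h2 : ∑ k, (start w k : List (List V)).length = 1 := by
      have := congrArg Multiset.card (sum_start (V := V) hw)
      rwa [Multiset.card_sum] at this
    rw [h2, if_pos hm, sum_start hw] at h1
    have h3 : (levelUnits D 0 {[]}).card ≤
        ∑ j ∈ Finset.range m, (levelUnits D j (arrived D (takenUp D w B' 0) j)).card :=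
      Finset.single_le_sum
        (f := fun j => (levelUnits D j (arrived D (takenUp D w B' 0) j)).card)
        (fun _ _ => Nat.zero_le _) (Finset.mem_range.2 hm)
    rw [scheduleUpTo, List.range_zero, List.flatMap_nil, List.append_nil]
    unfold potential
    omega
  | succ t ih =>
    have h0 : scheduleUpTo D B' w (t + 1) = scheduleUpTo D B' w t ++ batchSteps D B' w t := by
      unfold scheduleUpTo
      rw [List.range_succ, List.flatMap_append, List.append_assoc]
      simp
    rw [h0, totalCost_append]
    unfold batchSteps
    cases h : nextLevel m B' (stateAfter D w B' t) with
    | none =>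
      rw [takenUp, h]
      exact ih
    | some j =>
      rw [takenUp_succ_of_some h, potential_addBatch _ (nextLevel_eq_some h).1]
      have := totalCost_extendSteps_le (D := D) (B' := B') (stateAfter D w B' t) j
      dsimp only
      omega

lemma potential_le (hm : 0 < m) (hw : 0 < w) (hwB : w * w ≤ B') (hD : D.Covered)
    (hR : ∀ i, (D.rel i).Nonempty) (t : ℕ) :
    (potential D (takenUp D w B' t) : ℝ) ≤ (6 * n + 6) * (m * D.maxOut) := by
  have hI := invariant_stateAfter (D := D) hm hw hwB t
  have h1 : (∑ j ∈ Finset.range m, ((takenUp D w B' t j).card : ℝ)) ≤ m * D.maxOut :=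
    (Finset.sum_le_card_nsmul _ _ D.maxOut fun j hj =>
      hI.card_le hD hR (Finset.mem_range.1 hj)).trans (by simp)
  have h2 : (∑ j ∈ Finset.range m,
      ((levelUnits D j (arrived D (takenUp D w B' t) j)).card : ℝ)) ≤ m * D.maxOut :=
    (Finset.sum_le_card_nsmul _ _ D.maxOut fun j hj =>
      hI.card_levelUnits_arrived_le hD hR (Finset.mem_range.1 hj)).trans (by simp)
  unfold potential
  push_cast
  nlinarith [mul_le_mul_of_nonneg_left h1 (by positivity : (0 : ℝ) ≤ 6 * n + 4)]

lemma one_le_relations (hm : 0 < m) (hD : D.Covered) : 1 ≤ n := by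
  obtain ⟨i, -⟩ := hD ⟨0, hm⟩
  exact i.pos

lemma computation_le (hm : 0 < m) (hw : 0 < w) (hwB : w * w ≤ B') (hD : D.Covered)
    (hR : ∀ i, (D.rel i).Nonempty) (h : Key n V → Fin w) :
    (computation D B' h : ℝ) ≤ 16 * (m * n * D.maxOut) := by
  have h1 : computation D B' h ≤ totalCost (scheduleUpTo D B' w (numBatches D w B')) := by
    rw [computation, rounds_eq]
    exact sum_map_flatMap_le _ _ _ _ fun s _ => sum_comp_rounds_le h s
  have h2 := h1.trans (totalCost_scheduleUpTo_le hm hw _)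
  have h3 := potential_le hm hw hwB hD hR (numBatches D w B')
  have h4 : (computation D B' h : ℝ) ≤
      potential D (takenUp D w B' (numBatches D w B')) + (3 * n + 1) := by exact_mod_cast h2
  have hn : (1 : ℝ) ≤ n := by exact_mod_cast one_le_relations hm hD
  have hm' : (1 : ℝ) ≤ m := by exact_mod_cast hm
  have hM := one_le_maxOut D hD hR
  have h5 : (1 : ℝ) ≤ m * D.maxOut := by nlinarith
  have h6 : (6 * n + 6 : ℝ) * (m * D.maxOut) + (3 * n + 1) ≤ 16 * n * (m * D.maxOut) := by
    nlinarith [mul_le_mul hn h5 zero_le_one (by linarith)]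
  linarith

lemma communication_le_computation (hm : 0 < m) (hw : 0 < w) (hwB : w * w ≤ B')
    (h : Key n V → Fin w) : communication D B' h ≤ computation D B' h := by
  refine List.sum_le_sum fun r hr => ?_
  rw [rounds_eq] at hr
  obtain ⟨s, hs, hr⟩ := List.mem_flatMap.1 hr
  exact sum_received_le_sum_comp h (bounded_scheduleUpTo hm hw hwB _ s hs) hr

/-! ### Memory and number of rounds -/

lemma card_prefixes_le (i : Fin n) (j : ℕ) : (D.prefixes i j).card ≤ (D.rel i).card :=
  Finset.card_image_le

lemma sum_card_extOf_le (i : Fin n) (j : ℕ) :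
    ∑ q ∈ D.prefixes i j, (D.extOf i j q).card ≤ (D.rel i).card := by
  rw [Finset.card_eq_sum_card_image (D.restrict i j) (D.rel i)]
  refine Finset.sum_le_sum fun q _ => ?_
  unfold Instance.extOf
  refine Finset.card_biUnion_le.trans ?_
  refine (Finset.sum_le_card_nsmul _ _ 1 fun t _ => ?_).trans (by simp)
  cases D.value i t j <;> simp

lemma card_indexKeys_le : D.indexKeys.card ≤ 3 * (m * D.inputSize) := by
  unfold Instance.indexKeys
  refine Finset.card_biUnion_le.trans ?_
  have h1 : ∀ i, (((Finset.range m).filter (fun j => D.Binds i j)).biUnion fun j =>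
      (D.prefixes i j).image (Key.count i j) ∪
      ((D.prefixes i j).biUnion fun q =>
        (Finset.range (D.extOf i j q).card).image (Key.res i j q)) ∪
      (D.prefixes i (j + 1)).image (Key.mem i j)).card ≤ 3 * m * (D.rel i).card := by
    intro i
    refine Finset.card_biUnion_le.trans ?_
    refine (Finset.sum_le_card_nsmul _ _ (3 * (D.rel i).card) fun j _ => ?_).trans ?_
    · refine (Finset.card_union_le _ _).trans ?_
      have h2 := Finset.card_union_le ((D.prefixes i j).image (Key.count i j))
        ((D.prefixes i j).biUnion fun q =>
          (Finset.range (D.extOf i j q).card).image (Key.res i j q))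
      have h3 : ((D.prefixes i j).image (Key.count i j)).card ≤ (D.rel i).card :=
        Finset.card_image_le.trans (card_prefixes_le i j)
      have h4 : ((D.prefixes i (j + 1)).image (Key.mem i j)).card ≤ (D.rel i).card :=
        Finset.card_image_le.trans (card_prefixes_le i (j + 1))
      have h5 : ((D.prefixes i j).biUnion fun q =>
          (Finset.range (D.extOf i j q).card).image (Key.res i j q)).card ≤ (D.rel i).card := by
        refine Finset.card_biUnion_le.trans ((Finset.sum_le_sum fun q _ => ?_).trans
          (sum_card_extOf_le i j))
        exact Finset.card_image_le.trans (by simp)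
      omega
    · have h2 : ((Finset.range m).filter (fun j => D.Binds i j)).card ≤ m :=
        (Finset.card_filter_le _ _).trans (by simp)
      rw [smul_eq_mul]
      nlinarith [Nat.mul_le_mul_right (3 * (D.rel i).card) h2]
  refine (Finset.sum_le_sum fun i _ => h1 i).trans (le_of_eq ?_)
  rw [← Finset.mul_sum, Instance.inputSize]
  ring

lemma sum_indexSize (h : Key n V → Fin w) : ∑ k, indexSize D h k = D.indexKeys.card :=
  (Finset.card_eq_sum_card_fiberwise fun _ _ => Finset.mem_coe.2 (Finset.mem_univ _)).symm

lemma sum_held_received_le (hm : 0 < m) (h : Key n V → Fin w) {s : Step n V w}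
    (hs : s.Bounded m B') {r : Round w} (hr : r ∈ s.rounds h) :
    ∑ k, (r.held k + r.received k) ≤ 7 * (m * (w * B')) := by
  cases s with
  | lookup stored keys =>
    have h1 := length_requestMsgs_le h keys
    have h2 : ∑ k, (keys k).length ≤ w * B' :=
      (Finset.sum_le_card_nsmul _ _ _ fun k _ => hs.1 k).trans (by simp)
    have h3 := hs.2
    have h4 : w * B' ≤ m * (w * B') := Nat.le_mul_of_pos_left _ hm
    rw [Step.rounds, lookupRounds_eq, List.mem_pair] at hr
    rcases hr with rfl | rfl
    · rw [Finset.sum_add_distrib, sum_received]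
      simp only [Finset.sum_add_distrib]
      omega
    · rw [Finset.sum_add_distrib, sum_received, List.length_map]
      simp only [Finset.sum_add_distrib]
      omega
  | exchange r' =>
    obtain rfl := List.mem_singleton.1 hr
    exact hs.2.2.2.1

lemma foldr_max_le (L : List ℕ) (b : ℕ) (h : ∀ a ∈ L, a ≤ b) : L.foldr max 0 ≤ b := by
  induction L with
  | nil => exact Nat.zero_le _
  | cons a L ih =>
    exact max_le (h a (by simp)) (ih fun c hc => h c (by simp [hc]))

lemma memory_le (hm : 0 < m) (hw : 0 < w) (hwB : w * w ≤ B') (h : Key n V → Fin w) :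
    memory D B' h ≤ 3 * (m * D.inputSize) + 7 * (m * (w * B')) := by
  refine foldr_max_le _ _ fun a ha => ?_
  obtain ⟨r, hr, rfl⟩ := List.mem_map.1 ha
  rw [rounds_eq] at hr
  obtain ⟨s, hs, hr⟩ := List.mem_flatMap.1 hr
  rw [Finset.sum_add_distrib, sum_indexSize]
  have h1 := sum_held_received_le hm h (bounded_scheduleUpTo hm hw hwB _ s hs) hr
  have h2 := card_indexKeys_le (D := D)
  omega

lemma length_schedule_le (hm : 0 < m) (hw : 0 < w) (hwB : w * w ≤ B') (hD : D.Covered)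
    (hR : ∀ i, (D.rel i).Nonempty) :
    ((scheduleUpTo D B' w (numBatches D w B')).length : ℝ) ≤
      14 * (m * n * (⌈D.maxOut / (w * B' : ℕ)⌉₊ : ℝ)) := by
  have h1 := length_scheduleUpTo_le (D := D) (B' := B') (w := w) (numBatches D w B')
  have h1' : ((scheduleUpTo D B' w (numBatches D w B')).length : ℝ) ≤
      (n + 1) * (1 + 2 * numBatches D w B') := by exact_mod_cast h1
  have h2 := numBatches_le hm hw hwB hD hR
  have hM := one_le_maxOut D hD hR
  have hB : 0 < w * B' := by
    have : 0 < w * w := Nat.mul_pos hw hw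
    exact Nat.mul_pos hw (by omega)
  have hB' : (0 : ℝ) < (w * B' : ℕ) := by exact_mod_cast hB
  have h3 := Nat.le_ceil (D.maxOut / (w * B' : ℕ))
  have h4 : 1 ≤ ⌈D.maxOut / (w * B' : ℕ)⌉₊ :=
    Nat.one_le_ceil_iff.2 (div_pos (by linarith) hB')
  have h4' : (1 : ℝ) ≤ (⌈D.maxOut / (w * B' : ℕ)⌉₊ : ℝ) := by exact_mod_cast h4
  set X : ℝ := (⌈D.maxOut / (w * B' : ℕ)⌉₊ : ℝ)
  have hn : (1 : ℝ) ≤ n := by exact_mod_cast one_le_relations hm hD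
  have hm' : (1 : ℝ) ≤ m := by exact_mod_cast hm
  have h5 : (numBatches D w B' : ℝ) ≤ m * (3 * X) :=
    h2.trans (mul_le_mul_of_nonneg_left (by linarith) (by linarith))
  have h6 : (1 : ℝ) ≤ m * X := by nlinarith
  calc _ ≤ ((n : ℝ) + 1) * (1 + 2 * numBatches D w B') := h1'
    _ ≤ (2 * n) * (7 * (m * X)) := by
      refine mul_le_mul (by linarith) (by linarith) (by positivity) (by positivity)
    _ = _ := by ring

lemma length_rounds_le (h : Key n V → Fin w) : (rounds D B' h).length ≤
    2 * (scheduleUpTo D B' w (numBatches D w B')).length := by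
  rw [rounds_eq]
  exact length_flatMap_rounds_le _ _

end Schedule

/-! ## Concentration of the load of a random hash function -/

section Chernoff

/-- The weight of the key `κ` if it is hashed to worker `k`. -/
def hashedWeight {K Ω : Type*} {w : ℕ} (H : K → Ω → Fin w) (c : K → ℝ) (k : Fin w) (κ : K)
    (ω : Ω) : ℝ :=
  if H κ ω = k then c κ else 0

lemma exp_mul_hashedWeight {K Ω : Type*} {w : ℕ} {H : K → Ω → Fin w} (c : K → ℝ) (k : Fin w)
    (κ : K) (t : ℝ) :
    (fun ω => Real.exp (t * hashedWeight H c k κ ω)) =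
      fun ω => 1 + {ω | H κ ω = k}.indicator (fun _ => Real.exp (t * c κ) - 1) ω := by
  funext ω
  unfold hashedWeight
  by_cases h : H κ ω = k
  · rw [if_pos h, Set.indicator_of_mem (by exact h)]; ring
  · rw [if_neg h, Set.indicator_of_notMem (by exact h)]; simp

variable {K Ω : Type*} [MeasurableSpace Ω] {w : ℕ} {μ : Measure Ω}
  {H : K → Ω → Fin w}

lemma IsRandomHash.measurable_hashedWeight (hH : IsRandomHash μ H) (c : K → ℝ) (k : Fin w)
    (κ : K) : Measurable (hashedWeight H c k κ) :=
  (measurable_of_finite fun x : Fin w => if x = k then c κ else 0).comp (hH.measurable κ)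

lemma IsRandomHash.iIndepFun_hashedWeight (hH : IsRandomHash μ H) (c : K → ℝ) (k : Fin w) :
    iIndepFun (hashedWeight H c k) μ :=
  hH.indep.comp (fun κ x => if x = k then c κ else 0) fun _ => measurable_of_finite _

lemma IsRandomHash.measurableSet_eq (hH : IsRandomHash μ H) (κ : K) (k : Fin w) :
    MeasurableSet {ω | H κ ω = k} := hH.measurable κ (measurableSet_singleton k)

lemma IsRandomHash.integrable_exp_hashedWeight [IsProbabilityMeasure μ]
    (hH : IsRandomHash μ H) (c : K → ℝ) (k : Fin w)
    (κ : K) (t : ℝ) : Integrable (fun ω => Real.exp (t * hashedWeight H c k κ ω)) μ := by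
  rw [exp_mul_hashedWeight]
  exact (integrable_const _).add ((integrable_const _).indicator (hH.measurableSet_eq κ k))

lemma IsRandomHash.mgf_hashedWeight [IsProbabilityMeasure μ]
    (hH : IsRandomHash μ H) (c : K → ℝ) (k : Fin w)
    (κ : K) (t : ℝ) :
    mgf (hashedWeight H c k κ) μ t = 1 + (Real.exp (t * c κ) - 1) / w := by
  rw [mgf, exp_mul_hashedWeight, integral_add (integrable_const _)
    ((integrable_const _).indicator (hH.measurableSet_eq κ k)),
    integral_indicator_const _ (hH.measurableSet_eq κ k), hH.uniform]
  simp
  ring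

lemma IsRandomHash.measure_sum_ge_le [IsProbabilityMeasure μ]
    (hH : IsRandomHash μ H) (s : Finset K) {c : K → ℝ} {M A : ℝ}
    (hM : 0 < M) (hc0 : ∀ κ, 0 ≤ c κ) (hcM : ∀ κ, c κ ≤ M) (k : Fin w)
    (hA : ∑ κ ∈ s, c κ ≤ w * A) (T : ℝ) :
    μ.real {ω | T ≤ ∑ κ ∈ s, hashedWeight H c k κ ω} ≤ Real.exp ((2 * A - T) / M) := by
  have hw : (0 : ℝ) < w := by exact_mod_cast k.pos
  have hind := hH.iIndepFun_hashedWeight c k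
  have h1 : mgf (∑ κ ∈ s, hashedWeight H c k κ) μ (1 / M) ≤ Real.exp (2 * A / M) := by
    rw [hind.mgf_sum (hH.measurable_hashedWeight c k)]
    calc ∏ κ ∈ s, mgf (hashedWeight H c k κ) μ (1 / M)
        ≤ ∏ κ ∈ s, Real.exp (2 * c κ / (M * w)) := by
          refine Finset.prod_le_prod (fun κ _ => mgf_nonneg) fun κ _ => ?_
          rw [hH.mgf_hashedWeight]
          have h2 : |1 / M * c κ| ≤ 1 := by
            rw [abs_of_nonneg (mul_nonneg (by positivity) (hc0 κ)), one_div_mul_eq_div,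
              div_le_one hM]
            exact hcM κ
          have h3 := (le_abs_self _).trans (Real.abs_exp_sub_one_le h2)
          rw [abs_of_nonneg (mul_nonneg (by positivity) (hc0 κ))] at h3
          have h4 : (Real.exp (1 / M * c κ) - 1) / w ≤ 2 * c κ / (M * w) := by
            rw [div_le_iff₀ hw]
            refine h3.trans (le_of_eq ?_)
            field_simp
          have h5 := Real.add_one_le_exp (2 * c κ / (M * w))
          linarith
      _ = Real.exp (2 * (∑ κ ∈ s, c κ) / (M * w)) := by
          rw [← Real.exp_sum, Finset.mul_sum, Finset.sum_div]
      _ ≤ Real.exp (2 * A / M) := by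
          refine Real.exp_le_exp.2 ?_
          rw [div_le_div_iff₀ (by positivity) hM]
          have := mul_le_mul_of_nonneg_left hA (by positivity : (0 : ℝ) ≤ 2 * M)
          nlinarith
  have h2 := measure_ge_le_exp_mul_mgf (μ := μ) (X := ∑ κ ∈ s, hashedWeight H c k κ) T
    (t := 1 / M) (by positivity)
    (hind.integrable_exp_mul_sum (hH.measurable_hashedWeight c k)
      fun κ _ => hH.integrable_exp_hashedWeight c k κ _)
  simp only [Finset.sum_apply] at h2
  refine h2.trans ((mul_le_mul_of_nonneg_left h1 (Real.exp_nonneg _)).trans (le_of_eq ?_))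
  rw [← Real.exp_add]
  congr 1
  ring

end Chernoff

section HighProbability

variable {m n : ℕ} {V Ω : Type*} {D : Instance m n V} {w B' : ℕ} [MeasurableSpace Ω]
  {μ : Measure Ω} {H : Key n V → Ω → Fin w}

/-- The number of workers that request a key. -/
def demand (keys : Fin w → List (Key n V)) (κ : Key n V) : ℕ := ∑ l, if κ ∈ keys l then 1 else 0

lemma demand_le (keys : Fin w → List (Key n V)) (κ : Key n V) : demand keys κ ≤ w := by
  refine (Finset.sum_le_card_nsmul _ _ 1 fun l _ => ?_).trans (by simp)
  split_ifs <;> simp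

/-- All keys that are requested. -/
def requested (keys : Fin w → List (Key n V)) : Finset (Key n V) :=
  Finset.univ.biUnion fun l => (keys l).toFinset

lemma countP_dedup_eq (keys : Fin w → List (Key n V)) (p : Key n V → Prop) [DecidablePred p]
    (l : Fin w) :
    (keys l).dedup.countP (fun κ => p κ) =
      ∑ κ ∈ requested keys, if p κ then (if κ ∈ keys l then 1 else 0) else 0 := by
  have h1 : (requested keys).filter (fun κ => p κ ∧ κ ∈ keys l) =
      ((keys l).dedup.filter fun κ => p κ).toFinset := by
    ext κ
    simp only [requested, Finset.mem_filter, Finset.mem_biUnion, Finset.mem_univ, true_and,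
      List.mem_toFinset, List.mem_filter, List.mem_dedup, decide_eq_true_eq]
    exact ⟨fun h => ⟨h.2.2, h.2.1⟩, fun h => ⟨⟨l, h.1⟩, h.2, h.1⟩⟩
  rw [List.countP_eq_length_filter,
    ← List.toFinset_card_of_nodup ((List.nodup_dedup _).filter _), ← h1, Finset.card_filter]
  refine Finset.sum_congr rfl fun κ _ => ?_
  split_ifs <;> simp_all

lemma requests_eq (h : Key n V → Fin w) (keys : Fin w → List (Key n V)) (k : Fin w) :
    requests h keys k = ∑ κ ∈ requested keys, if h κ = k then demand keys κ else 0 := by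
  have h1 : ∀ l, (keys l).dedup.countP (fun κ => h κ = k) =
      ∑ κ ∈ requested keys, if h κ = k then (if κ ∈ keys l then 1 else 0) else 0 := fun l => by
    exact countP_dedup_eq keys (fun κ => h κ = k) l
  unfold requests demand
  rw [Finset.sum_congr rfl fun l _ => h1 l, Finset.sum_comm]
  refine Finset.sum_congr rfl fun κ _ => ?_
  split_ifs <;> simp

lemma sum_demand_le (keys : Fin w → List (Key n V)) :
    ∑ κ ∈ requested keys, demand keys κ ≤ ∑ l, (keys l).length := by
  unfold demand
  rw [Finset.sum_comm]
  refine Finset.sum_le_sum fun l _ => ?_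
  have h1 := countP_dedup_eq keys (fun _ => True) l
  simp only [if_true] at h1
  rw [← h1]
  exact List.countP_le_length.trans (List.dedup_sublist _).length_le

lemma IsRandomHash.measure_requests_gt_le [IsProbabilityMeasure μ]
    (hH : IsRandomHash μ H)
    {keys : Fin w → List (Key n V)} (hk : ∀ l, (keys l).length ≤ B') (k : Fin w) :
    μ.real {ω | 10 * B' < requests (fun κ => H κ ω) keys k} ≤ Real.exp (-(8 * (B' / w : ℝ))) := by
  have hw : (0 : ℝ) < w := by exact_mod_cast k.pos
  have h1 := hH.measure_sum_ge_le (requested keys) (c := fun κ => (demand keys κ : ℝ)) (M := w)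
    (A := B') hw (fun _ => Nat.cast_nonneg _) (fun κ => by exact_mod_cast demand_le keys κ) k
    (by
      have h2 : ∑ l, (keys l).length ≤ w * B' :=
        (Finset.sum_le_card_nsmul _ _ _ fun l _ => hk l).trans (by simp)
      exact_mod_cast (sum_demand_le keys).trans h2) (10 * B')
  refine (measureReal_mono fun ω hω => ?_).trans (h1.trans (le_of_eq ?_))
  · rw [Set.mem_ofPred_eq, requests_eq] at hω
    have h3 : ((10 * B' : ℕ) : ℝ) ≤
        ((∑ κ ∈ requested keys, if H κ ω = k then demand keys κ else 0 : ℕ) : ℝ) := by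
      exact_mod_cast hω.le
    push_cast at h3
    exact h3
  · congr 1
    ring

lemma IsRandomHash.measure_indexSize_gt_le [IsProbabilityMeasure μ]
    (hH : IsRandomHash μ H) (k : Fin w) :
    μ.real {ω | 6 * (m * D.inputSize / w : ℝ) + 10 * B' < indexSize D (fun κ => H κ ω) k} ≤
      Real.exp (-(8 * (B' / w : ℝ))) := by
  have hw1 : (1 : ℝ) ≤ w := by exact_mod_cast k.pos
  have hw : (0 : ℝ) < w := by linarith
  have h1 := hH.measure_sum_ge_le D.indexKeys (c := fun _ => (1 : ℝ)) (M := 1)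
    (A := 3 * (m * D.inputSize / w : ℝ)) one_pos (fun _ => zero_le_one) (fun _ => le_rfl) k
    (by
      have h2 := card_indexKeys_le (D := D)
      have h3 : (D.indexKeys.card : ℝ) ≤ 3 * (m * D.inputSize) := by exact_mod_cast h2
      rw [Finset.sum_const, nsmul_eq_mul, mul_one]
      refine h3.trans (le_of_eq ?_)
      field_simp) (6 * (m * D.inputSize / w : ℝ) + 10 * B')
  refine (measureReal_mono fun ω hω => ?_).trans (h1.trans (Real.exp_le_exp.2 ?_))
  · rw [Set.mem_ofPred_eq] at hω ⊢
    refine hω.le.trans (le_of_eq ?_)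
    unfold indexSize hashedWeight
    rw [Finset.card_filter]
    push_cast
    rfl
  · have h2 : (B' / w : ℝ) ≤ B' := div_le_self (Nat.cast_nonneg _) hw1
    have h3 : (0 : ℝ) ≤ B' := Nat.cast_nonneg _
    linarith

/-- No worker gets too many requests in the step. -/
def Step.Light (B' : ℕ) (h : Key n V → Fin w) : Step n V w → Prop
  | lookup _ keys => ∀ k, requests h keys k ≤ 10 * B'
  | exchange _ => True

lemma IsRandomHash.measure_not_light_le [IsProbabilityMeasure μ]
    (hH : IsRandomHash μ H) {s : Step n V w}
    (hs : s.Bounded m B') :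
    μ.real {ω | ¬ s.Light B' fun κ => H κ ω} ≤ w * Real.exp (-(8 * (B' / w : ℝ))) := by
  cases s with
  | lookup stored keys =>
    have h1 : {ω | ¬ (Step.lookup stored keys).Light B' fun κ => H κ ω} =
        ⋃ k, {ω | 10 * B' < requests (fun κ => H κ ω) keys k} := by
      ext ω
      simp [Step.Light]
    rw [h1]
    refine (measureReal_iUnion_fintype_le _).trans ?_
    refine (Finset.sum_le_card_nsmul _ _ _ fun k _ =>
      hH.measure_requests_gt_le hs.1 k).trans (by simp)
  | exchange r =>
    simp only [Step.Light, not_true, Set.ofPred_false, measureReal_empty]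
    positivity

lemma measureReal_exists_mem_le {α : Type*} (L : List α) (p : α → Ω → Prop) (b : ℝ)
    (h : ∀ a ∈ L, μ.real {ω | p a ω} ≤ b) : μ.real {ω | ∃ a ∈ L, p a ω} ≤ L.length * b := by
  induction L with
  | nil => simp
  | cons a L ih =>
    have h1 : {ω | ∃ a' ∈ a :: L, p a' ω} = {ω | p a ω} ∪ {ω | ∃ a' ∈ L, p a' ω} := by
      ext ω
      simp
    rw [h1]
    refine (measureReal_union_le _ _).trans ?_
    have h2 := h a (by simp)
    have h3 := ih fun a' ha' => h a' (by simp [ha'])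
    rw [List.length_cons]
    push_cast
    linarith

/-- The event that all look-ups and the index are evenly distributed. -/
def Even (D : Instance m n V) (B' : ℕ) (L : List (Step n V w)) (h : Key n V → Fin w) : Prop :=
  (∀ s ∈ L, s.Light B' h) ∧
    ∀ k, (indexSize D h k : ℝ) ≤ 6 * (m * D.inputSize / w : ℝ) + 10 * B'

lemma IsRandomHash.measure_even_ge [IsProbabilityMeasure μ]
    (hH : IsRandomHash μ H) {L : List (Step n V w)}
    (hL : ∀ s ∈ L, s.Bounded m B') :
    1 - (L.length + 1) * (w * Real.exp (-(8 * (B' / w : ℝ)))) ≤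
      μ.real {ω | Even D B' L fun κ => H κ ω} := by
  have h1 : (Set.univ : Set Ω) ⊆ {ω | Even D B' L fun κ => H κ ω} ∪
      ({ω | ∃ s ∈ L, ¬ s.Light B' fun κ => H κ ω} ∪
        ⋃ k, {ω | 6 * (m * D.inputSize / w : ℝ) + 10 * B' < indexSize D (fun κ => H κ ω) k}) := by
    intro ω _
    simp only [Set.mem_union, Set.mem_ofPred_eq, Set.mem_iUnion, Even]
    by_cases h2 : ∃ s ∈ L, ¬ s.Light B' fun κ => H κ ω
    · exact Or.inr (Or.inl h2)
    · by_cases h3 : ∃ k, 6 * (m * D.inputSize / w : ℝ) + 10 * B' < indexSize D (fun κ => H κ ω) k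
      · exact Or.inr (Or.inr h3)
      · push Not at h2 h3
        exact Or.inl ⟨h2, h3⟩
  have h2 := (measureReal_mono h1).trans ((measureReal_union_le _ _).trans
    (add_le_add_right (measureReal_union_le (μ := μ) _ _) _))
  rw [probReal_univ] at h2
  have h3 := measureReal_exists_mem_le L (fun s ω => ¬ s.Light B' fun κ => H κ ω) _
    fun s hs => hH.measure_not_light_le (hL s hs)
  have h4 : μ.real (⋃ k, {ω | 6 * (m * D.inputSize / w : ℝ) + 10 * B' <
      indexSize D (fun κ => H κ ω) k}) ≤ w * Real.exp (-(8 * (B' / w : ℝ))) := by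
    refine (measureReal_iUnion_fintype_le _).trans ?_
    exact (Finset.sum_le_card_nsmul _ _ _ fun k _ =>
      hH.measure_indexSize_gt_le k).trans (by simp)
  linarith

/-! ## Consequences of an even distribution -/

lemma Step.Light.round_bounds {h : Key n V → Fin w} {s : Step n V w} (hl : s.Light B' h)
    (hs : s.Bounded m B') {r : Round w} (hr : r ∈ s.rounds h) (k : Fin w) :
    r.sent k + r.received k ≤ 11 * B' ∧ r.comp k ≤ 11 * B' ∧ r.received k ≤ 10 * B' := by
  cases s with
  | lookup stored keys =>
    have h1 := hs.1 k
    have h2 := hl k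
    have h3 := countP_fst_requestMsgs_le h keys k
    have h4 := countP_snd_requestMsgs h keys k
    rw [Step.rounds, lookupRounds_eq, List.mem_pair] at hr
    rcases hr with rfl | rfl
    · simp only [Round.sent, Round.received]
      omega
    · simp only [Round.sent, Round.received, List.countP_map]
      have h5 : (requestMsgs h keys).countP
          ((fun e : Fin w × Fin w => decide (e.1 = k)) ∘ Prod.swap) =
          (requestMsgs h keys).countP (fun e => e.2 = k) := rfl
      have h6 : (requestMsgs h keys).countP
          ((fun e : Fin w × Fin w => decide (e.2 = k)) ∘ Prod.swap) =
          (requestMsgs h keys).countP (fun e => e.1 = k) := rfl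
      rw [h5, h6]
      omega
  | exchange r' =>
    obtain rfl := List.mem_singleton.1 hr
    have h1 := hs.1 k
    have h2 := hs.2.1 k
    have h3 := hs.2.2.1 k
    omega

lemma Even.load_le (hm : 0 < m) (hn : 1 ≤ n) (hw : 0 < w) (hB : 0 < B') {h : Key n V → Fin w}
    (he : Even D B' (scheduleUpTo D B' w (numBatches D w B')) h)
    (hs : ∀ s ∈ scheduleUpTo D B' w (numBatches D w B'), s.Bounded m B') :
    (load D B' h : ℝ) ≤ 10 * (m * n * D.inputSize / w + m * B') := by
  have hm' : (1 : ℝ) ≤ m := by exact_mod_cast hm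
  have hn' : (1 : ℝ) ≤ n := by exact_mod_cast hn
  have hw' : (0 : ℝ) < w := by exact_mod_cast hw
  have hB' : (1 : ℝ) ≤ B' := by exact_mod_cast hB
  have hI : (0 : ℝ) ≤ D.inputSize / w := by positivity
  have e1 : (m * n * D.inputSize / w : ℝ) = m * n * (D.inputSize / w) := by ring
  have e2 : (m * D.inputSize / w : ℝ) = m * (D.inputSize / w) := by ring
  have h1 : (D.inputSize / w : ℝ) ≤ m * (D.inputSize / w) := le_mul_of_one_le_left hI hm'
  have h2 : (m * (D.inputSize / w) : ℝ) ≤ m * n * (D.inputSize / w) :=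
    mul_le_mul_of_nonneg_right (le_mul_of_one_le_right (by linarith) hn') hI
  have h3 : (B' : ℝ) ≤ m * B' := le_mul_of_one_le_left (by linarith) hm'
  have h4 : (0 : ℝ) ≤ m * (D.inputSize / w) := by positivity
  rw [e1]
  unfold load
  rw [Nat.cast_max, Nat.cast_max]
  refine max_le ?_ (max_le ?_ ?_)
  · refine (Nat.cast_div_le).trans ?_
    rw [div_le_iff₀ hw']
    have h5 : ((D.inputSize + w - 1 : ℕ) : ℝ) ≤ D.inputSize + w := by
      exact_mod_cast Nat.sub_le _ _
    have h6 : (D.inputSize + w : ℝ) = (D.inputSize / w + 1) * w := by field_simp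
    rw [h6] at h5
    exact h5.trans (mul_le_mul_of_nonneg_right (by linarith) hw'.le)
  · obtain ⟨k, -, hk⟩ := Finset.exists_mem_eq_sup (Finset.univ : Finset (Fin w))
      ⟨⟨0, hw⟩, Finset.mem_univ _⟩ fun k => indexSize D h k
    rw [hk]
    refine (he.2 k).trans ?_
    rw [e2]
    linarith
  · have h5 : ((rounds D B' h).map fun r => Finset.univ.sup fun k => r.received k).foldr max 0
        ≤ 10 * B' := by
      refine foldr_max_le _ _ fun a ha => ?_
      obtain ⟨r, hr, rfl⟩ := List.mem_map.1 ha
      rw [rounds_eq] at hr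
      obtain ⟨s, hs', hr⟩ := List.mem_flatMap.1 hr
      exact Finset.sup_le fun k _ => ((he.1 s hs').round_bounds (hs s hs') hr k).2.2
    have h6 : ((((rounds D B' h).map fun r => Finset.univ.sup fun k => r.received k).foldr max 0
        : ℕ) : ℝ) ≤ 10 * B' := by exact_mod_cast h5
    refine h6.trans ?_
    linarith

lemma inputSize_div_le_placementLoad (hw : 0 < w)
    (place : (Σ i : Fin n, {t // t ∈ D.rel i}) → Fin w) :
    (D.inputSize / w : ℝ) ≤ placementLoad D place := by
  have h1 : D.inputSize = ∑ k, (Finset.univ.filter fun s => place s = k).card := by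
    rw [← Finset.card_eq_sum_card_fiberwise fun _ _ => Finset.mem_coe.2 (Finset.mem_univ _),
      Finset.card_univ, Fintype.card_sigma, Instance.inputSize]
    simp
  have h2 : D.inputSize ≤ w * placementLoad D place := by
    rw [h1]
    refine (Finset.sum_le_card_nsmul _ _ (placementLoad D place) fun k _ => ?_).trans (by simp)
    exact Finset.le_sup (f := fun k => (Finset.univ.filter fun s => place s = k).card)
      (Finset.mem_univ k)
  rw [div_le_iff₀ (by exact_mod_cast hw), mul_comm]
  exact_mod_cast h2

lemma relations_le_inputSize (hR : ∀ i, (D.rel i).Nonempty) : n ≤ D.inputSize := by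
  refine le_trans (by simp) (Finset.card_nsmul_le_sum Finset.univ (fun i => (D.rel i).card) 1
    fun i _ => (hR i).card_pos)

/-- The failure probability of the union bound. -/
lemma failure_le (hm : 0 < m) (hw : 0 < w) (hD : D.Covered)
    (hR : ∀ i, (D.rel i).Nonempty)
    (hB : max (w : ℝ) (Real.log (D.inputSize * D.maxOut)) ≤ (B' : ℝ) / w) {N : ℝ}
    (hN : N ≤ 14 * (m * n * (⌈D.maxOut / (w * B' : ℕ)⌉₊ : ℝ))) :
    (N + 1) * (w * Real.exp (-(8 * (B' / w : ℝ)))) ≤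
      30 * (max 1 ((m : ℝ) / D.inputSize) / D.inputSize) := by
  have hM := one_le_maxOut D hD hR
  have hn := one_le_relations hm hD
  have hnI := relations_le_inputSize hR
  have hn' : (1 : ℝ) ≤ n := by exact_mod_cast hn
  have hm' : (1 : ℝ) ≤ m := by exact_mod_cast hm
  have hnI' : (n : ℝ) ≤ D.inputSize := by exact_mod_cast hnI
  have hw1 : (1 : ℝ) ≤ w := by exact_mod_cast hw
  set L : ℝ := (B' : ℝ) / w with hLdef
  have hwL : (w : ℝ) ≤ L := (le_max_left _ _).trans hB
  have hlog : Real.log (D.inputSize * D.maxOut) ≤ L := (le_max_right _ _).trans hB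
  set I : ℝ := (D.inputSize : ℝ)
  set X : ℝ := D.maxOut
  have hI1 : 1 ≤ I := hn'.trans hnI'
  have hIX : I * X ≤ Real.exp L := by
    rw [← Real.exp_log (by nlinarith : (0 : ℝ) < I * X)]
    exact Real.exp_le_exp.2 hlog
  have hE1 : 1 ≤ Real.exp L := by
    have := Real.add_one_le_exp L
    linarith
  have hwE : (w : ℝ) ≤ Real.exp L := by
    have := Real.add_one_le_exp L
    linarith
  have hIE : I ≤ Real.exp L := (le_mul_of_one_le_right (by linarith) hM).trans hIX
  have hB1 : (1 : ℝ) ≤ (w * B' : ℕ) := by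
    have h1 : (B' : ℝ) = L * w := by rw [hLdef]; field_simp
    push_cast
    rw [h1]
    nlinarith [mul_le_mul hw1 (hw1.trans hwL) zero_le_one (by linarith)]
  have hceil : (⌈X / (w * B' : ℕ)⌉₊ : ℝ) ≤ 2 * X := by
    have h1 := (Nat.ceil_lt_add_one (div_nonneg (by linarith : (0 : ℝ) ≤ X)
      (by linarith : (0 : ℝ) ≤ (w * B' : ℕ)))).le
    have h2 : X / (w * B' : ℕ) ≤ X := div_le_self (by linarith) hB1
    linarith
  have h1 : N + 1 ≤ 30 * (m * Real.exp L) := by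
    have h2 : n * (⌈X / (w * B' : ℕ)⌉₊ : ℝ) ≤ 2 * Real.exp L := by
      calc n * (⌈X / (w * B' : ℕ)⌉₊ : ℝ) ≤ I * (2 * X) :=
            mul_le_mul hnI' hceil (Nat.cast_nonneg _) (by linarith)
        _ ≤ 2 * Real.exp L := by linarith
    have h3 := mul_le_mul_of_nonneg_left h2 (by linarith : (0 : ℝ) ≤ m)
    have h4 : 1 ≤ m * Real.exp L := by nlinarith
    nlinarith
  have h2 : Real.exp (-(8 * L)) * Real.exp L ^ 8 = 1 := by
    rw [← Real.exp_nat_mul, ← Real.exp_add]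
    simp
  have hE0 := Real.exp_pos (-(8 * L))
  have h3 : (N + 1) * (w * Real.exp (-(8 * L))) ≤ 30 * (m / (I * I)) := by
    calc (N + 1) * (w * Real.exp (-(8 * L)))
        ≤ (30 * (m * Real.exp L)) * (Real.exp L * Real.exp (-(8 * L))) := by
          refine mul_le_mul h1 (mul_le_mul_of_nonneg_right hwE hE0.le) (by positivity)
            (by positivity)
      _ ≤ 30 * (m / (I * I)) := by
          have h4 : Real.exp L ^ 2 * Real.exp (-(8 * L)) * (I * I) ≤ 1 := by
            calc Real.exp L ^ 2 * Real.exp (-(8 * L)) * (I * I)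
                ≤ Real.exp L ^ 2 * Real.exp (-(8 * L)) * (Real.exp L * Real.exp L) := by
                  refine mul_le_mul_of_nonneg_left ?_ (by positivity)
                  exact mul_le_mul hIE hIE (by linarith) (by linarith)
              _ = Real.exp (-(8 * L)) * Real.exp L ^ 4 := by ring
              _ ≤ Real.exp (-(8 * L)) * Real.exp L ^ 8 :=
                  mul_le_mul_of_nonneg_left (pow_le_pow_right₀ hE1 (by norm_num)) hE0.le
              _ = 1 := h2
          have h5 : Real.exp L ^ 2 * Real.exp (-(8 * L)) ≤ 1 / (I * I) := by
            rw [le_div_iff₀ (by positivity)]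
            exact h4
          calc _ = 30 * m * (Real.exp L ^ 2 * Real.exp (-(8 * L))) := by ring
            _ ≤ 30 * m * (1 / (I * I)) := mul_le_mul_of_nonneg_left h5 (by positivity)
            _ = _ := by ring
  refine h3.trans (mul_le_mul_of_nonneg_left ?_ (by norm_num))
  rw [← div_div]
  exact div_le_div_of_nonneg_right (le_max_right _ _) (by linarith)

end HighProbability

end BiGJoinS

end

theorem theorem3p4 :
    ∃ C : ℝ, ∀ (m n : ℕ) (V : Type*) (D : BiGJoinS.Instance m n V) (w B' : ℕ),
      0 < m → D.Covered → (∀ i, (D.rel i).Nonempty) → 0 < w →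
      max (w : ℝ) (Real.log (D.inputSize * D.maxOut)) ≤ (B' : ℝ) / w →
      -- the computation ends, with the results of the query as output
      ((∃ t, BiGJoinS.nextLevel m B' (BiGJoinS.stateAfter D w B' t) = none) ∧
        ∀ p : List V, p ∈ (BiGJoinS.stateAfter D w B' (BiGJoinS.numBatches D w B')).out ↔
          ∃ x : Fin m → V, D.IsResult x ∧ p = List.ofFn x) ∧
      -- bounds that hold for every distribution of the index entries
      (∀ h : BiGJoinS.Key n V → Fin w,
        (BiGJoinS.computation D B' h : ℝ) ≤ C * (m * n * D.maxOut) ∧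
        (BiGJoinS.communication D B' h : ℝ) ≤ C * (m * n * D.maxOut) ∧
        (BiGJoinS.memory D B' h : ℝ) ≤ C * (m * n * D.inputSize + m * (w * B' : ℕ)) ∧
        ((BiGJoinS.rounds D B' h).length : ℝ) ≤
          C * (m * n * (⌈D.maxOut / (w * B' : ℕ)⌉₊ : ℝ))) ∧
      -- bounds that hold with high probability for a random hash function
      (∀ (Ω : Type*) [MeasurableSpace Ω] (μ : MeasureTheory.Measure Ω)
        [MeasureTheory.IsProbabilityMeasure μ] (H : BiGJoinS.Key n V → Ω → Fin w),
        BiGJoinS.IsRandomHash μ H →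
        1 - C * (max 1 ((m : ℝ) / D.inputSize) / D.inputSize) ≤
          μ.real {ω |
            (∀ r ∈ BiGJoinS.rounds D B' (fun κ => H κ ω), ∀ k : Fin w,
              ((r.sent k + r.received k : ℕ) : ℝ) ≤ C * B' ∧ (r.comp k : ℝ) ≤ C * B') ∧
            (BiGJoinS.load D B' (fun κ => H κ ω) : ℝ) ≤
              C * (m * n * D.inputSize / w + m * B') ∧
            ((B' : ℝ) < D.inputSize / w →
              ∀ place : (Σ i : Fin n, {t // t ∈ D.rel i}) → Fin w,
                (BiGJoinS.load D B' (fun κ => H κ ω) : ℝ) ≤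
                  C * (m * n * BiGJoinS.placementLoad D place))}) := by
  refine ⟨30, fun m n V D w B' hm hD hR hw hB => ?_⟩
  have hw' : (0 : ℝ) < w := by exact_mod_cast hw
  have hwB : w * w ≤ B' := by
    have h1 : (w : ℝ) ≤ B' / w := (le_max_left _ _).trans hB
    rw [le_div_iff₀ hw'] at h1
    exact_mod_cast h1
  have hB0 : 0 < B' := lt_of_lt_of_le (Nat.mul_pos hw hw) hwB
  have hM := BiGJoinS.one_le_maxOut D hD hR
  have hn : 1 ≤ n := BiGJoinS.one_le_relations hm hD
  have hn' : (1 : ℝ) ≤ n := by exact_mod_cast hn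
  have hm' : (1 : ℝ) ≤ m := by exact_mod_cast hm
  have hlen := BiGJoinS.length_schedule_le hm hw hwB hD hR
  have hbd := BiGJoinS.bounded_scheduleUpTo (D := D) hm hw hwB (BiGJoinS.numBatches D w B')
  refine ⟨⟨BiGJoinS.exists_nextLevel_eq_none hm hw hwB hD hR,
    BiGJoinS.mem_out_iff hm hw hwB hD hR⟩, fun h => ?_, fun Ω _ μ _ H hH => ?_⟩
  · have hc := BiGJoinS.computation_le hm hw hwB hD hR h
    have h0 : (0 : ℝ) ≤ m * n * D.maxOut := by positivity
    have h1 : (BiGJoinS.communication D B' h : ℝ) ≤ BiGJoinS.computation D B' h := by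
      exact_mod_cast BiGJoinS.communication_le_computation hm hw hwB h
    refine ⟨by linarith, by linarith, ?_, ?_⟩
    · have h2 : (BiGJoinS.memory D B' h : ℝ) ≤ 3 * (m * D.inputSize) + 7 * (m * (w * B' : ℕ)) := by
        exact_mod_cast BiGJoinS.memory_le hm hw hwB h
      have h3 : (m * D.inputSize : ℝ) ≤ m * n * D.inputSize :=
        mul_le_mul_of_nonneg_right (le_mul_of_one_le_right (by linarith) hn') (Nat.cast_nonneg _)
      have h4 : (0 : ℝ) ≤ m * (w * B' : ℕ) := by positivity
      have h5 : (0 : ℝ) ≤ m * D.inputSize := by positivity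
      linarith
    · have h2 : ((BiGJoinS.rounds D B' h).length : ℝ) ≤
          2 * (BiGJoinS.scheduleUpTo D B' w (BiGJoinS.numBatches D w B')).length := by
        exact_mod_cast BiGJoinS.length_rounds_le h
      have h3 : (0 : ℝ) ≤ m * n * (⌈D.maxOut / (w * B' : ℕ)⌉₊ : ℝ) := by positivity
      linarith
  · have hE := hH.measure_even_ge (D := D) hbd
    have hF := BiGJoinS.failure_le hm hw hD hR hB hlen
    refine le_trans (by linarith) (hE.trans (MeasureTheory.measureReal_mono fun ω hω => ?_))
    have hB0' : (0 : ℝ) ≤ B' := Nat.cast_nonneg _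
    have hl := BiGJoinS.Even.load_le hm hn hw hB0 hω hbd
    have h0 : (0 : ℝ) ≤ m * n * D.inputSize / w + m * B' := by positivity
    refine ⟨fun r hr k => ?_, by linarith, fun hlt place => ?_⟩
    · rw [BiGJoinS.rounds_eq] at hr
      obtain ⟨s, hs, hr⟩ := List.mem_flatMap.1 hr
      obtain ⟨h1, h2, -⟩ := (hω.1 s hs).round_bounds (hbd s hs) hr k
      have h1' : ((r.sent k + r.received k : ℕ) : ℝ) ≤ 11 * B' := by exact_mod_cast h1
      have h2' : (r.comp k : ℝ) ≤ 11 * B' := by exact_mod_cast h2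
      exact ⟨by linarith, by linarith⟩
    · have h1 := BiGJoinS.inputSize_div_le_placementLoad hw place
      have h2 : (m * n * D.inputSize / w : ℝ) = m * n * (D.inputSize / w) := by ring
      have h3 : (m * B' : ℝ) ≤ m * n * (D.inputSize / w) :=
        mul_le_mul (le_mul_of_one_le_right (by linarith) hn') hlt.le hB0' (by positivity)
      have h4 : (m * n * (D.inputSize / w) : ℝ) ≤ m * n * BiGJoinS.placementLoad D place :=
        mul_le_mul_of_nonneg_left h1 (by positivity)
      have h5 : (0 : ℝ) ≤ m * n * BiGJoinS.placementLoad D place := by positivity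
      linarith
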